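/- A tournament is a pair $T=(V,E)$ where $V$ is a (finite or infinite) set of vertices and $E\subseteq V\times V$ is an irreflexive, antisymmetric and complete relation; it is acyclic if it contains no $3$-element cycle. A set $A\subseteq V$ is autonomous if for all $x,x'\in A$ and $y\in V\setminus A$ one has $(x,y)\in E\iff (x',y)\in E$. The acyclic component of $x \in V$ is the union of all autonomous sets $A\ni x$ on which $T$ induces an acyclic tournament. The lexicographical sum of tournaments $T_i$ indexed by a tournament $D$ is the tournament on the disjoint union of the vertex sets of the $T_i$ in which there is an edge from $x\in V(T_i)$ to $y\in V(T_j)$ if either $i=j$ and $(x,y)\in E(T_i)$, or $(i,j)\in E(D)$. The profile of $T$ is the function $\varphi_T$ such that, for each integer $n \ge 0$, $\varphi_T(n)$ is the number of tournaments induced by $T$ on the $n$-element subsets of $V$, isomorphic tournaments being identified. Theorem. Let $T$ be a tournament which is (isomorphic to) a lexicographical sum of acyclic tournaments indexed by a finite tournament. Then the number $k$ of infinite acyclic components of $T$ is finite, the generating series of the profile is a rational fraction of the form $$\sum_{n=0}^{\infty}\varphi_T(n)x^n=\frac{P(x)}{(1-x)(1-x^2)\cdots(1-x^k)}$$ with $P(x)\in\mathbb{Z}[x]$,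 and $\varphi_T(n)\simeq a\,n^{k-1}$ as $n\to\infty$ for some non-negative real $a$, which is positive if $k\ge 1$. Here $\simeq$ is asymptotic equivalence: $f\simeq g$ means $f-g=o(g)$ (the quotient tends to $1$ where $g$ does not vanish; for $g=0$ it means that $f(n)=0$ for all large $n$, which occurs for $k=0$, that is, for $T$ finite). -/

import Mathlib

/-- A tournament on the vertex set `V` (finite or infinite): a binary relation `Adj`
(`Adj x y` says that `(x, y)` is an edge) that is irreflexive, antisymmetric and complete. -/
structure Tournament (V : Type*) extends Digraph V where
  irrefl : ∀ x, ¬ Adj x x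
  antisymm : ∀ x y, Adj x y → Adj y x → x = y
  complete : ∀ x y, x ≠ y → Adj x y ∨ Adj y x

namespace Tournament

/-- Isomorphisms of tournaments: bijections that preserve and reflect edges. -/
abbrev Iso {V W : Type*} (T : Tournament V) (S : Tournament W) : Type _ :=
  T.Adj ≃r S.Adj

/-- The restriction of `T` to a set `A` of vertices. -/
def induce {V : Type*} (T : Tournament V) (A : Set V) : Tournament A where
  Adj x y := T.Adj x y
  irrefl x := T.irrefl x
  antisymm x y h h' := Subtype.ext (T.antisymm x y h h')
  complete x y h := T.complete x y (fun e => h (Subtype.ext e))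

/-- A tournament is acyclic if it contains no `3`-element cycle. -/
def IsAcyclic {V : Type*} (T : Tournament V) : Prop :=
  ∀ a b c : V, ¬ (T.Adj a b ∧ T.Adj b c ∧ T.Adj c a)

/-- The lexicographical sum of the tournaments `S i` indexed by the tournament `D`: its vertex
set is the disjoint union of the vertex sets of the `S i`, and there is an edge from `(i, x)` to
`(j, y)` if `(i, j)` is an edge of `D`, or if `i = j` and `(x, y)` is an edge of `S i`. -/
def lexSum {I : Type*} {W : I → Type*} (D : Tournament I) (S : ∀ i, Tournament (W i)) :
    Tournament (Σ i, W i) where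
  Adj := Sigma.Lex D.Adj (fun i => (S i).Adj)
  irrefl := by
    rintro ⟨i, x⟩ h
    cases h with
    | left _ _ h => exact D.irrefl i h
    | right _ _ h => exact (S i).irrefl x h
  antisymm := by
    rintro ⟨i, x⟩ ⟨j, y⟩ h h'
    cases h with
    | left _ _ h =>
      cases h' with
      | left _ _ h' =>
        obtain rfl := D.antisymm i j h h'
        exact absurd h (D.irrefl i)
      | right _ _ h' => exact absurd h (D.irrefl i)
    | right _ _ h =>
      cases h' with
      | left _ _ h' => exact absurd h' (D.irrefl i)
      | right _ _ h' => exact congrArg (Sigma.mk i) ((S i).antisymm _ _ h h')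
  complete := by
    rintro ⟨i, x⟩ ⟨j, y⟩ h
    by_cases hij : i = j
    · subst hij
      have hxy : x ≠ y := fun e => h (by rw [e])
      exact ((S i).complete x y hxy).imp (Sigma.Lex.right x y) (Sigma.Lex.right y x)
    · exact (D.complete i j hij).imp (Sigma.Lex.left x y) (Sigma.Lex.left y x)

/-- A set `A` of vertices is autonomous if every vertex outside `A` is related in the same way
to all elements of `A`. -/
def IsAutonomous {V : Type*} (T : Tournament V) (A : Set V) : Prop :=
  ∀ x ∈ A, ∀ x' ∈ A, ∀ y ∉ A, (T.Adj x y ↔ T.Adj x' y)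

/-- The union of all acyclic autonomous sets of vertices that contain `x`. -/
def acyclicComponent {V : Type*} (T : Tournament V) (x : V) : Set V :=
  ⋃₀ {A : Set V | T.IsAutonomous A ∧ (T.induce A).IsAcyclic ∧ x ∈ A}

/-- The set of acyclic components of `T`. -/
def acyclicComponents {V : Type*} (T : Tournament V) : Set (Set V) :=
  Set.range T.acyclicComponent

/-- Two `n`-element sets of vertices are identified when they induce isomorphic tournaments. -/
def isoSetoid {V : Type*} (T : Tournament V) (n : ℕ) :
    Setoid {A : Finset V // A.card = n} where
  r A B := Nonempty (Iso (T.induce (A.1 : Set V)) (T.induce (B.1 : Set V)))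
  iseqv :=
    { refl := fun _ => ⟨RelIso.refl _⟩
      symm := fun ⟨e⟩ => ⟨e.symm⟩
      trans := fun ⟨e⟩ ⟨f⟩ => ⟨e.trans f⟩ }

/-- The profile of `T`: the number of tournaments induced by `T` on the `n`-element sets of
vertices, isomorphic tournaments being identified. -/
noncomputable def profile {V : Type*} (T : Tournament V) (n : ℕ) : ℕ :=
  Nat.card (Quotient (T.isoSetoid n))

/-- The generating series of the profile. -/
noncomputable def profileSeries {V : Type*} (T : Tournament V) : PowerSeries ℤ :=
  PowerSeries.mk fun n => (T.profile n : ℤ)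

end Tournament

/-! A finite tournament decomposes uniquely as a reduced tournament `D` (one whose acyclic
autonomous sets have at most one element) whose vertices are replaced by finite chains: the chains
are its acyclic components. For a finite subtournament of `T`, distinct chains come from distinct
components of `T`, so their number `r` is bounded. Isomorphism types of `n`-element subtournaments
are thus orbits of the symmetric groups on pairs (`D`, chain lengths), as `r` varies
(`profile_eq_sum_card_orbits`).

Burnside's lemma reduces the count to pairs fixed by a permutation `σ`. For a `σ`-invariant `D`,
these are the points of a lower set in `ℕ ^ Q`, with `Q` the set of cycles of `σ`, weighted by cycle
length. Chains that can all grow without bound need distinct infinite components, so the lower set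
is unbounded only along sets of cycles of total length at most `k`.

Such a lower set has a series with denominator `(1 - X) ⋯ (1 - X ^ k)`
(`hasDenominator_weightedCount_fin`). The proof inducts on slices and translates, using Dickson's
lemma and the fact that one of any `w` consecutive integers is a multiple of `w`.

The denominator forces the profile divided by `n ^ (k - 1)` to converge when `k ≥ 1`. The limit is
positive because `k` chain lengths can be chosen freely while one further infinite component absorbs
the remainder. -/

open Filter Topology

/-! ### Power series with denominator `(1 - X) ⋯ (1 - X ^ k)` -/

/-- The generating series of `f` is a rational fraction with denominator
`(1 - X) (1 - X ^ 2) ⋯ (1 - X ^ k)`. -/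
def HasDenominator (k : ℕ) (f : ℕ → ℚ) : Prop :=
  ∃ P : Polynomial ℚ,
    PowerSeries.mk f * ∏ i ∈ Finset.Icc 1 k, (1 - PowerSeries.X ^ i) = (P : PowerSeries ℚ)

namespace HasDenominator

theorem zero (k : ℕ) : HasDenominator k (fun _ => 0) :=
  ⟨0, by
    have : PowerSeries.mk (fun _ : ℕ => (0 : ℚ)) = 0 := by ext; simp
    simp [this]⟩

theorem add {k : ℕ} {f g : ℕ → ℚ} (hf : HasDenominator k f) (hg : HasDenominator k g) :
    HasDenominator k (fun n => f n + g n) := by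
  obtain ⟨P, hP⟩ := hf
  obtain ⟨Q, hQ⟩ := hg
  refine ⟨P + Q, ?_⟩
  have : PowerSeries.mk (fun n => f n + g n) = PowerSeries.mk f + PowerSeries.mk g := by ext; simp
  rw [this, add_mul, hP, hQ, Polynomial.coe_add]

theorem sum {k : ℕ} {ι : Type*} (s : Finset ι) {f : ι → ℕ → ℚ}
    (hf : ∀ i ∈ s, HasDenominator k (f i)) :
    HasDenominator k (fun n => ∑ i ∈ s, f i n) := by
  classical
  induction s using Finset.induction_on with
  | empty => simpa using zero k
  | insert a s ha ih =>
    simp only [Finset.sum_insert ha]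
    exact (hf a (by simp)).add (ih fun i hi => hf i (by simp [hi]))

theorem const_mul {k : ℕ} {f : ℕ → ℚ} (c : ℚ) (hf : HasDenominator k f) :
    HasDenominator k (fun n => c * f n) := by
  obtain ⟨P, hP⟩ := hf
  refine ⟨Polynomial.C c * P, ?_⟩
  have : PowerSeries.mk (fun n => c * f n) = PowerSeries.C c * PowerSeries.mk f := by ext; simp
  rw [this, mul_assoc, hP]
  simp

theorem congr {k : ℕ} {f g : ℕ → ℚ} (hf : HasDenominator k f) (h : ∀ n, g n = f n) :
    HasDenominator k g := by
  rwa [funext h]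

/-- The binomial `1 - X ^ w` divides a product of such binomials over `w` consecutive exponents. -/
theorem one_sub_X_pow_dvd (j w : ℕ) (hw : 0 < w) :
    (1 - Polynomial.X ^ w : Polynomial ℚ) ∣
      ∏ i ∈ Finset.Ioc j (j + w), (1 - Polynomial.X ^ i) := by
  -- The least multiple of `w` above `j`.
  have hmem : w * (j / w + 1) ∈ Finset.Ioc j (j + w) := by
    have h1 := Nat.div_add_mod j w
    have h2 := Nat.mod_lt j hw
    rw [Finset.mem_Ioc, mul_add]
    constructor <;> omega
  refine dvd_trans ?_ (Finset.dvd_prod_of_mem _ hmem)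
  rw [pow_mul]
  simpa using sub_dvd_pow_sub_pow (1 : Polynomial ℚ) (Polynomial.X ^ w) (j / w + 1)

theorem prod_Icc_eq {j k : ℕ} (h : j ≤ k) :
    (∏ i ∈ Finset.Icc 1 k, (1 - PowerSeries.X ^ i) : PowerSeries ℚ) =
      (∏ i ∈ Finset.Icc 1 j, (1 - PowerSeries.X ^ i)) *
        ((∏ i ∈ Finset.Ioc j k, (1 - Polynomial.X ^ i) : Polynomial ℚ) : PowerSeries ℚ) := by
  have h1 : ∀ n, Finset.Icc 1 n = Finset.Ioc 0 n := fun n => by ext; simp; omega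
  have h2 : ((∏ i ∈ Finset.Ioc j k, (1 - Polynomial.X ^ i) : Polynomial ℚ) : PowerSeries ℚ) =
      ∏ i ∈ Finset.Ioc j k, (1 - PowerSeries.X ^ i) := by
    rw [← Polynomial.coeToPowerSeries.ringHom_apply, map_prod]
    simp
  rw [h2, h1, h1, Finset.prod_Ioc_consecutive _ (Nat.zero_le j) h]

theorem mono {j k : ℕ} {f : ℕ → ℚ} (h : j ≤ k) (hf : HasDenominator j f) :
    HasDenominator k f := by
  obtain ⟨P, hP⟩ := hf
  exact ⟨P * ∏ i ∈ Finset.Ioc j k, (1 - Polynomial.X ^ i), by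
    rw [prod_Icc_eq h, ← mul_assoc, hP, Polynomial.coe_mul]⟩

theorem shift {k : ℕ} {f g : ℕ → ℚ} (w : ℕ) (hf : HasDenominator k f)
    (hg : PowerSeries.mk g = PowerSeries.X ^ w * PowerSeries.mk f) : HasDenominator k g := by
  obtain ⟨P, hP⟩ := hf
  refine ⟨Polynomial.X ^ w * P, ?_⟩
  rw [hg, mul_assoc, hP]
  simp

/-- A new factor `1 - X ^ w` is absorbed by the `w` consecutive factors with exponents `k + 1, …, k
+ w`. This is why weights add up to a bound on the denominator. -/
theorem of_one_sub_mul {k w : ℕ} (hw : 0 < w) {f g : ℕ → ℚ} (hf : HasDenominator k f)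
    (hg : (1 - PowerSeries.X ^ w) * PowerSeries.mk g = PowerSeries.mk f) :
    HasDenominator (k + w) g := by
  obtain ⟨P, hP⟩ := hf
  obtain ⟨R, hR⟩ := one_sub_X_pow_dvd k w hw
  refine ⟨P * R, ?_⟩
  rw [prod_Icc_eq (Nat.le_add_right k w), hR, Polynomial.coe_mul, Polynomial.coe_mul, ← hP, ← hg]
  simp only [Polynomial.coe_sub, Polynomial.coe_one, Polynomial.coe_pow, Polynomial.coe_X]
  ring

end HasDenominator

/-! ### Growth of coefficients -/

/-- The difference of powers is `c` times a sum of `d + 1` terms `n ^ i * (n - c) ^ (d - i)`, each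
asymptotic to `n ^ d`. -/
theorem tendsto_pow_sub_pow_div (c d : ℕ) :
    Tendsto (fun n : ℕ => ((n : ℝ) ^ (d + 1) - ((n : ℝ) - c) ^ (d + 1)) / (n : ℝ) ^ d) atTop
      (𝓝 (c * (d + 1))) := by
  have h1 : Tendsto (fun n : ℕ => 1 - (c : ℝ) / n) atTop (𝓝 1) := by
    simpa using tendsto_const_nhds.sub (tendsto_const_div_atTop_nhds_zero_nat (c : ℝ))
  have h2 : Tendsto (fun n : ℕ => c * ∑ i ∈ Finset.range (d + 1), (1 - (c : ℝ) / n) ^ (d - i))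
      atTop (𝓝 (c * (d + 1))) := by
    have := (tendsto_finsetSum (Finset.range (d + 1))
      fun i _ => h1.pow (d - i)).const_mul (c : ℝ)
    simpa using this
  refine h2.congr' ?_
  filter_upwards [eventually_gt_atTop 0] with n hn
  have hn' : (n : ℝ) ≠ 0 := by positivity
  rw [← (Commute.all (n : ℝ) ((n : ℝ) - c)).mul_geom_sum₂, sub_sub_cancel, mul_div_assoc,
    Finset.sum_div]
  congr 1
  refine Finset.sum_congr rfl fun i hi => ?_
  have hi' : i ≤ d := by simpa [Nat.lt_succ_iff] using hi
  rw [show (1 - (c : ℝ) / n) = (n - c) / n by field_simp, div_pow]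
  have : (n : ℝ) ^ d = n ^ i * n ^ (d - i) := by rw [← pow_add]; congr 1; omega
  rw [this, show d + 1 - 1 - i = d - i by omega]
  field_simp

/-- Increments below `ε * n ^ d` accumulate to at most `ε * n ^ (d + 1)` plus a constant; the
induction closes because `(n - c) ^ (d + 1) ≤ n ^ d * (n - 1)`. -/
theorem tendsto_div_pow_of_sub_tendsto_zero {c d : ℕ} (hc : 0 < c) {h : ℕ → ℝ}
    (hh : Tendsto (fun n => (h n - h (n - c)) / (n : ℝ) ^ d) atTop (𝓝 0)) :
    Tendsto (fun n => h n / (n : ℝ) ^ (d + 1)) atTop (𝓝 0) := by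
  have key : ∀ ε > (0 : ℝ), ∃ M : ℝ, ∀ n, |h n| ≤ M + ε * (n : ℝ) ^ (d + 1) := by
    intro ε hε
    obtain ⟨N, hN⟩ := Metric.tendsto_atTop.1 hh ε hε
    refine ⟨∑ i ∈ Finset.range (N + c), |h i|, fun n => ?_⟩
    induction n using Nat.strong_induction_on with
    | _ n ih =>
      by_cases hn : n < N + c
      · have := Finset.single_le_sum (f := fun i => |h i|) (fun i _ => abs_nonneg _)
          (Finset.mem_range.2 hn)
        have h2 : 0 ≤ ε * (n : ℝ) ^ (d + 1) := by positivity
        linarith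
      · have hpos : (0 : ℝ) < (n : ℝ) ^ d := by
          have : 0 < n := by omega
          positivity
        have h1 := hN n (by omega)
        rw [Real.dist_eq, sub_zero, abs_div, abs_of_pos hpos, div_lt_iff₀ hpos] at h1
        have h2 := ih (n - c) (by omega)
        have h3 : ((n - c : ℕ) : ℝ) ^ (d + 1) ≤ (n : ℝ) ^ d * (n - 1) := by
          have e : ((n - c : ℕ) : ℝ) ≤ n - 1 := by
            have : n - c + 1 ≤ n := by omega
            have : ((n - c : ℕ) : ℝ) + 1 ≤ n := by exact_mod_cast this
            linarith
          have e' : ((n - c : ℕ) : ℝ) ≤ n := by linarith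
          rw [pow_succ]
          gcongr
        have h4 : |h n| ≤ |h (n - c)| + |h n - h (n - c)| := by
          have := abs_add_le (h (n - c)) (h n - h (n - c))
          simpa using this
        have h5 : ε * ((n - c : ℕ) : ℝ) ^ (d + 1) ≤ ε * ((n : ℝ) ^ d * (n - 1)) := by gcongr
        have h6 : ε * (n : ℝ) ^ (d + 1) = ε * ((n : ℝ) ^ d * (n - 1)) + ε * (n : ℝ) ^ d := by
          rw [pow_succ]; ring
        linarith
  rw [Metric.tendsto_atTop]
  intro ε hε
  obtain ⟨M, hM⟩ := key (ε / 2) (by positivity)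
  have hlim : Tendsto (fun n : ℕ => M / (n : ℝ) ^ (d + 1)) atTop (𝓝 0) :=
    tendsto_const_nhds.div_atTop
      ((tendsto_pow_atTop (Nat.succ_ne_zero d)).comp tendsto_natCast_atTop_atTop)
  obtain ⟨N, hN⟩ := Metric.tendsto_atTop.1 hlim (ε / 2) (by positivity)
  refine ⟨N + 1, fun n hn => ?_⟩
  have hpos : (0 : ℝ) < (n : ℝ) ^ (d + 1) := by
    have : 0 < n := by omega
    positivity
  have h1 := hN n (by omega)
  rw [Real.dist_eq, sub_zero] at h1 ⊢
  rw [abs_div, abs_of_pos hpos] at h1 ⊢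
  rw [div_lt_iff₀ hpos] at h1 ⊢
  have := hM n
  have := le_abs_self M
  linarith

/-- The constant `b` is chosen so that `b * n ^ (d + 1)` has the same leading increments as `f`; the
difference is then negligible. -/
theorem exists_tendsto_div_pow_of_sub {c d : ℕ} (hc : 0 < c) {f g : ℕ → ℝ} {a : ℝ}
    (hfg : ∀ᶠ n in atTop, f n - f (n - c) = g n)
    (hg : Tendsto (fun n : ℕ => g n / (n : ℝ) ^ d) atTop (𝓝 a)) :
    ∃ b, Tendsto (fun n : ℕ => f n / (n : ℝ) ^ (d + 1)) atTop (𝓝 b) := by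
  set b : ℝ := a / (c * (d + 1)) with hb
  have hcd : (c : ℝ) * (d + 1) ≠ 0 := by positivity
  have h0 : Tendsto (fun n : ℕ => (f n - b * (n : ℝ) ^ (d + 1)) / (n : ℝ) ^ (d + 1))
      atTop (𝓝 0) := by
    refine tendsto_div_pow_of_sub_tendsto_zero (h := fun n => f n - b * (n : ℝ) ^ (d + 1)) hc ?_
    have h1 := hg.sub ((tendsto_pow_sub_pow_div c d).const_mul b)
    rw [hb, div_mul_cancel₀ _ hcd, sub_self] at h1
    refine h1.congr' ?_
    filter_upwards [hfg, eventually_ge_atTop c] with n hn hnc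
    rw [← hn, Nat.cast_sub hnc]
    ring
  refine ⟨b, ?_⟩
  have h1 := h0.add_const b
  rw [zero_add] at h1
  refine h1.congr' ?_
  filter_upwards [eventually_gt_atTop 0] with n hn
  have : (n : ℝ) ^ (d + 1) ≠ 0 := by positivity
  field_simp
  ring

theorem coeff_mul_one_sub_X_pow {R : Type*} [CommRing R] (F : PowerSeries R) {c n : ℕ}
    (h : c ≤ n) : PowerSeries.coeff n (F * (1 - PowerSeries.X ^ c)) =
      PowerSeries.coeff n F - PowerSeries.coeff (n - c) F := by
  rw [mul_sub, mul_one, map_sub, PowerSeries.coeff_mul_X_pow', if_pos h]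

theorem Polynomial.eventually_coeff_coe_eq_zero {R : Type*} [CommRing R] (P : Polynomial R) :
    ∀ᶠ n in atTop, PowerSeries.coeff n (P : PowerSeries R) = 0 := by
  filter_upwards [eventually_gt_atTop P.natDegree] with n hn
  rw [Polynomial.coeff_coe, Polynomial.coeff_eq_zero_of_natDegree_lt hn]

/-- Multiplying by `1 - X ^ c` takes differences of coefficients at distance `c`, so each factor
peeled off raises the exponent by one. With the single factor `1 - X` the coefficients are
eventually constant. The limit may vanish here; positivity needs a separate lower bound. -/
theorem exists_tendsto_coeff_div_pow (P : Polynomial ℝ) (k : ℕ) (F : PowerSeries ℝ)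
    (hF : F * ∏ i ∈ Finset.Icc 1 (k + 1), (1 - PowerSeries.X ^ i) = (P : PowerSeries ℝ)) :
    ∃ a, Tendsto (fun n : ℕ => PowerSeries.coeff n F / (n : ℝ) ^ k) atTop (𝓝 a) := by
  induction k generalizing F with
  | zero =>
    have h1 : ∀ᶠ n in atTop, PowerSeries.coeff n F - PowerSeries.coeff (n - 1) F = 0 := by
      filter_upwards [P.eventually_coeff_coe_eq_zero, eventually_ge_atTop 1] with n hn h1
      rw [← hn, ← hF, Finset.prod_Icc_succ_top (by omega)]
      simp only [zero_add, Finset.Icc_eq_empty_of_lt one_pos, Finset.prod_empty, one_mul]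
      rw [coeff_mul_one_sub_X_pow _ h1]
    obtain ⟨N, hN⟩ := eventually_atTop.1 h1
    refine ⟨PowerSeries.coeff N F, tendsto_const_nhds.congr' ?_⟩
    filter_upwards [eventually_ge_atTop N] with n hn
    induction n, hn using Nat.le_induction with
    | base => simp
    | succ n hn ih =>
      have := hN (n + 1) (by omega)
      simp only [pow_zero, div_one, Nat.add_sub_cancel] at *
      linarith
  | succ k ih =>
    rw [Finset.prod_Icc_succ_top (by omega), mul_comm (∏ i ∈ _, _), ← mul_assoc] at hF
    obtain ⟨a, ha⟩ := ih _ hF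
    refine exists_tendsto_div_pow_of_sub (c := k + 1 + 1) (by omega) ?_ ha
    filter_upwards [eventually_ge_atTop (k + 1 + 1)] with n hn
    rw [coeff_mul_one_sub_X_pow _ hn]

namespace HasDenominator

theorem exists_tendsto {k : ℕ} {f : ℕ → ℚ} (hf : HasDenominator (k + 1) f) :
    ∃ a : ℝ, Tendsto (fun n : ℕ => (f n : ℝ) / (n : ℝ) ^ k) atTop (𝓝 a) := by
  obtain ⟨P, hP⟩ := hf
  have h := congrArg (PowerSeries.map (algebraMap ℚ ℝ)) hP
  rw [map_mul, map_prod, ← Polynomial.polynomial_map_coe] at h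
  simp only [map_sub, map_one, map_pow, PowerSeries.map_X] at h
  obtain ⟨a, ha⟩ := exists_tendsto_coeff_div_pow _ k _ h
  exact ⟨a, by simpa using ha⟩

theorem eventually_eq_zero {f : ℕ → ℚ} (hf : HasDenominator 0 f) : ∀ᶠ n in atTop, f n = 0 := by
  obtain ⟨P, hP⟩ := hf
  filter_upwards [P.eventually_coeff_coe_eq_zero] with n hn
  rw [← hn, ← hP]
  simp

/-- The product is already an integral series, and equality with a rational polynomial makes its
coefficients vanish eventually; hence truncation loses nothing. -/
theorem exists_int_polynomial {k : ℕ} {f : ℕ → ℤ} (hf : HasDenominator k (fun n => (f n : ℚ))) :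
    ∃ P : Polynomial ℤ,
      PowerSeries.mk f * ∏ i ∈ Finset.Icc 1 k, (1 - PowerSeries.X ^ i) = (P : PowerSeries ℤ) := by
  obtain ⟨P, hP⟩ := hf
  set F := PowerSeries.mk f * ∏ i ∈ Finset.Icc 1 k, (1 - PowerSeries.X ^ i) with hF
  have h : PowerSeries.map (Int.castRingHom ℚ) F = (P : PowerSeries ℚ) := by
    rw [← hP, hF, map_mul, map_prod]
    congr 1
    · ext; simp
  obtain ⟨N, hN⟩ := eventually_atTop.1 P.eventually_coeff_coe_eq_zero
  refine ⟨PowerSeries.trunc N F, ?_⟩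
  ext n
  rw [Polynomial.coeff_coe, PowerSeries.coeff_trunc]
  split_ifs with hn
  · rfl
  · have := hN n (by omega)
    rw [← h, PowerSeries.coeff_map] at this
    simpa using this

end HasDenominator

/-! ### Counting points of lower sets by weight -/

/-- In a strictly descending sequence, pick a point lost at each step. Two of these satisfy `x i ≤ x
j` with `i < j`; since `x j` survives in `f (i + 1)`, so does `x i`, a contradiction. -/
theorem LowerSet.wellFoundedLT_of_wellQuasiOrderedLE {α : Type*} [Preorder α]
    [WellQuasiOrderedLE α] : WellFoundedLT (LowerSet α) := by
  refine ⟨RelEmbedding.wellFounded_iff_isEmpty.2 ⟨fun f => ?_⟩⟩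
  have hlt : ∀ i j, i < j → f j < f i := fun i j h => f.map_rel_iff.2 h
  have h : ∀ i, ∃ x, x ∈ f i ∧ x ∉ f (i + 1) := fun i =>
    Set.not_subset.1 (LowerSet.coe_subset_coe.not.2 (hlt i (i + 1) i.lt_succ_self).not_ge)
  choose x hx hx' using h
  obtain ⟨i, j, hij, hle⟩ := wellQuasiOrdered_le x
  have hji : f j ≤ f (i + 1) := by
    rcases (Nat.succ_le_of_lt hij).eq_or_lt with h | h
    · exact (congrArg f h).ge
    · exact (hlt _ _ h).le
  exact hx' i (hji ((f j).lower hle (hx j)))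

/-- The number of points `μ` of `Y` for which the weighted sum of the numbers `μ i + 1` is `n`. -/
noncomputable def weightedCount {ι : Type*} [Fintype ι] (w : ι → ℕ) (Y : Set (ι → ℕ)) (n : ℕ) : ℕ :=
  {μ | μ ∈ Y ∧ ∑ i, w i * (μ i + 1) = n}.ncard

theorem finite_setOf_weightedSum_eq {ι : Type*} [Fintype ι] {w : ι → ℕ} (hw : ∀ i, 0 < w i)
    (Y : Set (ι → ℕ)) (n : ℕ) : {μ | μ ∈ Y ∧ ∑ i, w i * (μ i + 1) = n}.Finite := by
  classical
  refine (Set.finite_Icc (0 : ι → ℕ) (fun _ => n)).subset ?_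
  rintro μ ⟨-, h⟩
  refine ⟨fun i => Nat.zero_le _, fun i => ?_⟩
  have h1 := Finset.single_le_sum (f := fun i => w i * (μ i + 1)) (fun _ _ => Nat.zero_le _)
    (Finset.mem_univ i)
  have h2 := Nat.le_mul_of_pos_left (μ i + 1) (hw i)
  simp only at h1 ⊢
  omega

namespace LowerSet

/-- The points of a lower set whose first coordinate is `0`, in the remaining coordinates. -/
def zeroSlice {s : ℕ} (Y : LowerSet (Fin (s + 1) → ℕ)) : LowerSet (Fin s → ℕ) where
  carrier := {μ | Fin.cons 0 μ ∈ Y}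
  lower' := fun a b hba ha => Y.lower (by
    intro i
    refine Fin.cases ?_ (fun j => ?_) i
    · simp
    · simpa using hba j) ha

/-- Translation of a lower set by `-1` along the first coordinate. -/
def headShift {s : ℕ} (Y : LowerSet (Fin (s + 1) → ℕ)) : LowerSet (Fin (s + 1) → ℕ) where
  carrier := {μ | Fin.cons (μ 0 + 1) (Fin.tail μ) ∈ Y}
  lower' := fun a b hba ha => Y.lower (by
    intro i
    refine Fin.cases ?_ (fun j => ?_) i
    · simpa using hba 0
    · simpa [Fin.tail] using hba j.succ) ha

theorem mem_zeroSlice {s : ℕ} {Y : LowerSet (Fin (s + 1) → ℕ)} {μ : Fin s → ℕ} :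
    μ ∈ Y.zeroSlice ↔ (Fin.cons 0 μ : Fin (s + 1) → ℕ) ∈ Y := Iff.rfl

theorem mem_headShift {s : ℕ} {Y : LowerSet (Fin (s + 1) → ℕ)} {μ : Fin (s + 1) → ℕ} :
    μ ∈ Y.headShift ↔ (Fin.cons (μ 0 + 1) (Fin.tail μ) : Fin (s + 1) → ℕ) ∈ Y := Iff.rfl

theorem headShift_le {s : ℕ} (Y : LowerSet (Fin (s + 1) → ℕ)) : Y.headShift ≤ Y := by
  intro μ hμ
  refine Y.lower ?_ (mem_headShift.1 hμ)
  intro i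
  refine Fin.cases ?_ (fun j => ?_) i
  · simp
  · simp [Fin.tail]

/-- Points split according to whether the first coordinate is zero or positive. Deleting a zero
coordinate or lowering a positive one by `1` reduces the weight by exactly `w 0`, since a coordinate
`μ i` counts as `μ i + 1`. -/
theorem weightedCount_add {s : ℕ} {w : Fin (s + 1) → ℕ} (hw : ∀ i, 0 < w i)
    (Y : LowerSet (Fin (s + 1) → ℕ)) (n : ℕ) :
    weightedCount w Y (n + w 0) =
      weightedCount (Fin.tail w) Y.zeroSlice n + weightedCount w Y.headShift n := by
  let f : (Fin s → ℕ) → (Fin (s + 1) → ℕ) := fun μ => Fin.cons 0 μ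
  let g : (Fin (s + 1) → ℕ) → (Fin (s + 1) → ℕ) := fun μ => Fin.cons (μ 0 + 1) (Fin.tail μ)
  have hf : Function.Injective f := Fin.cons_right_injective (α := fun _ => ℕ) 0
  have hg : Function.Injective g := by
    intro a b h
    have h' := Fin.cons_injective2 h
    rw [← Fin.cons_self_tail a, ← Fin.cons_self_tail b, h'.2, Nat.succ_injective h'.1]
  unfold weightedCount
  have hfin := finite_setOf_weightedSum_eq hw (Y : Set _) (n + w 0)
  have hunion : {μ | μ ∈ (Y : Set _) ∧ ∑ i, w i * (μ i + 1) = n + w 0} =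
      f '' {μ | μ ∈ (Y.zeroSlice : Set _) ∧ ∑ i, Fin.tail w i * (μ i + 1) = n} ∪
      g '' {μ | μ ∈ (Y.headShift : Set _) ∧ ∑ i, w i * (μ i + 1) = n} := by
    ext μ
    simp only [Set.mem_ofPred_eq, Set.mem_union, Set.mem_image, SetLike.mem_coe, mem_zeroSlice,
      mem_headShift, Fin.sum_univ_succ]
    constructor
    · rintro ⟨hY, hs⟩
      rcases h0 : μ 0 with _ | t
      · have e : f (Fin.tail μ) = μ := by simp only [f, ← h0, Fin.cons_self_tail]
        refine Or.inl ⟨Fin.tail μ, ⟨?_, ?_⟩, e⟩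
        · exact e ▸ hY
        · rw [h0] at hs
          simp only [Fin.tail]
          omega
      · have e : g (Fin.cons t (Fin.tail μ)) = μ := by
          simp only [g, Fin.cons_zero, Fin.tail_cons, ← h0, Fin.cons_self_tail]
        refine Or.inr ⟨Fin.cons t (Fin.tail μ), ⟨?_, ?_⟩, e⟩
        · have e' := e
          simp only [g] at e'
          rw [e']
          exact hY
        · rw [h0, mul_add (w 0) (t + 1) 1] at hs
          simp only [Fin.cons_zero, Fin.cons_succ, Fin.tail]
          omega
    · rintro (⟨ν, ⟨hY, hs⟩, rfl⟩ | ⟨ν, ⟨hY, hs⟩, rfl⟩)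
      · refine ⟨hY, ?_⟩
        simp only [Fin.tail, f, Fin.cons_zero, Fin.cons_succ] at hs ⊢
        omega
      · refine ⟨hY, ?_⟩
        simp only [Fin.tail, g, Fin.cons_zero, Fin.cons_succ] at hs ⊢
        rw [mul_add (w 0) (ν 0 + 1) 1]
        omega
  rw [hunion] at hfin ⊢
  rw [Set.ncard_union_eq ?_ (hfin.subset Set.subset_union_left)
    (hfin.subset Set.subset_union_right), Set.ncard_image_of_injective _ hf,
    Set.ncard_image_of_injective _ hg]
  rw [Set.disjoint_left]
  rintro _ ⟨a, -, rfl⟩ ⟨b, -, h⟩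
  have := congrFun h 0
  simp [f, g] at this

theorem weightedCount_of_lt {s : ℕ} {w : Fin (s + 1) → ℕ}
    (Y : LowerSet (Fin (s + 1) → ℕ)) {n : ℕ} (hn : n < w 0) : weightedCount w Y n = 0 := by
  unfold weightedCount
  refine (congrArg Set.ncard (Set.eq_empty_iff_forall_notMem.2 ?_)).trans (Set.ncard_empty _)
  rintro μ ⟨-, h⟩
  rw [Fin.sum_univ_succ, mul_add] at h
  omega

theorem mk_weightedCount {s : ℕ} {w : Fin (s + 1) → ℕ} (hw : ∀ i, 0 < w i)
    (Y : LowerSet (Fin (s + 1) → ℕ)) :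
    PowerSeries.mk (fun n => (weightedCount w Y n : ℚ)) =
      PowerSeries.X ^ w 0 * (PowerSeries.mk (fun n =>
        (weightedCount (Fin.tail w) Y.zeroSlice n : ℚ)) +
          PowerSeries.mk (fun n => (weightedCount w Y.headShift n : ℚ))) := by
  ext n
  rw [PowerSeries.coeff_X_pow_mul', PowerSeries.coeff_mk]
  split_ifs with h
  · obtain ⟨n, rfl⟩ := Nat.exists_eq_add_of_le' h
    simp [weightedCount_add hw]
  · simp [weightedCount_of_lt Y (not_le.1 h)]

theorem weightedCount_zero_dim (w : Fin 0 → ℕ) (Y : LowerSet (Fin 0 → ℕ)) {n : ℕ} (hn : 0 < n) :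
    weightedCount w Y n = 0 := by
  unfold weightedCount
  refine (congrArg Set.ncard (Set.eq_empty_iff_forall_notMem.2 ?_)).trans (Set.ncard_empty _)
  rintro μ ⟨-, h⟩
  simp at h
  omega

/-- If a lower set is unbounded only along sets of coordinates of total weight at most `k`, then
the series that counts its points by weight has denominator `(1 - X) ⋯ (1 - X ^ k)`. -/
theorem hasDenominator_weightedCount_fin {s : ℕ} {w : Fin s → ℕ} (hw : ∀ i, 0 < w i)
    (Y : LowerSet (Fin s → ℕ)) {k : ℕ}
    (hk : ∀ A : Finset (Fin s), (∀ N, ∃ μ ∈ Y, ∀ i ∈ A, N ≤ μ i) → ∑ i ∈ A, w i ≤ k) :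
    HasDenominator k (fun n => (weightedCount w Y n : ℚ)) := by
  induction s generalizing k with
  | zero =>
    refine HasDenominator.mono (Nat.zero_le k) ⟨Polynomial.C (weightedCount w Y 0 : ℚ), ?_⟩
    ext n
    rcases n with _ | n
    · simp
    · simp [weightedCount_zero_dim w Y n.succ_pos]
  | succ s ih =>
    -- Dickson's lemma permits an inner induction on `Y` itself.
    have : WellFoundedLT (LowerSet (Fin (s + 1) → ℕ)) :=
      wellFoundedLT_of_wellQuasiOrderedLE
    induction Y using WellFoundedLT.induction with
    | _ Y ihY =>
      have hwt : ∀ i, 0 < Fin.tail w i := fun i => hw i.succ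
      -- Either the translate is strictly smaller and the recursion adds two known series, or `Y` is
      -- a cylinder over its slice and the recursion divides the shifted slice series by `1 - X ^ w
      -- 0`.
      rcases Y.headShift_le.lt_or_eq with hlt | heq
      · have h1 : HasDenominator k (fun n => (weightedCount (Fin.tail w) Y.zeroSlice n : ℚ)) := by
          refine ih hwt _ fun A hA => ?_
          have := hk (A.map (Fin.succEmb s)) fun N => by
            obtain ⟨μ, hμ, hN⟩ := hA N
            exact ⟨_, hμ, by simpa using hN⟩
          simpa [Fin.tail] using this
        have h2 := ihY _ hlt fun A hA => hk A fun N => by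
          obtain ⟨μ, hμ, hN⟩ := hA N
          exact ⟨μ, hlt.le hμ, hN⟩
        refine (h1.add h2).shift (w 0) ?_
        rw [mk_weightedCount hw]
        congr 1
      -- For empty `Y` the hypothesis `hk` is vacuous and would not give `w 0 ≤ k`.
      · rcases (Y : Set (Fin (s + 1) → ℕ)).eq_empty_or_nonempty with hY | ⟨μ₀, hμ₀⟩
        · refine (HasDenominator.zero k).congr fun n => ?_
          simp [weightedCount, hY]
        have hcons : ∀ (N : ℕ) (μ : Fin s → ℕ), μ ∈ Y.zeroSlice →
            (Fin.cons N μ : Fin (s + 1) → ℕ) ∈ Y := by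
          intro N μ hμ
          induction N with
          | zero => exact hμ
          | succ N ihN =>
            rw [← heq, mem_headShift] at ihN
            simpa using ihN
        -- In a cylinder the first coordinate can be added to any unbounded set, so the slice only
        -- needs the budget `k - w 0`.
        have hA : ∀ A : Finset (Fin s), (∀ N, ∃ μ ∈ Y.zeroSlice, ∀ i ∈ A, N ≤ μ i) →
            w 0 + ∑ i ∈ A, Fin.tail w i ≤ k := by
          intro A hA
          have := hk (Finset.cons 0 (A.map (Fin.succEmb s)) (by simp)) fun N => by
            obtain ⟨μ, hμ, hN⟩ := hA N
            exact ⟨_, hcons N μ hμ, by simpa using hN⟩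
          simpa [Fin.tail] using this
        have hne : Fin.tail μ₀ ∈ Y.zeroSlice := by
          refine Y.lower ?_ hμ₀
          intro i
          refine Fin.cases ?_ (fun j => ?_) i
          · simp
          · simp [Fin.tail]
        have h0 : w 0 ≤ k := by simpa using hA ∅ fun N => ⟨_, hne, by simp⟩
        obtain ⟨j, rfl⟩ := Nat.exists_eq_add_of_le' h0
        have h1 : HasDenominator j (fun n => (weightedCount (Fin.tail w) Y.zeroSlice n : ℚ)) :=
          ih hwt _ fun A hA' => by
            have := hA A hA'
            omega
        refine HasDenominator.of_one_sub_mul (hw 0)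
          (f := fun n => PowerSeries.coeff n (PowerSeries.X ^ w 0 * PowerSeries.mk fun n =>
            (weightedCount (Fin.tail w) Y.zeroSlice n : ℚ)))
          (h1.shift (w 0) (by ext n; simp)) ?_
        have h := mk_weightedCount hw Y
        rw [heq, mul_add] at h
        rw [sub_mul, one_mul, sub_eq_iff_eq_add]
        nth_rewrite 1 [h]
        congr 1
        ext n
        simp

theorem hasDenominator_weightedCount {ι : Type*} [Fintype ι] {w : ι → ℕ} (hw : ∀ i, 0 < w i)
    (Y : LowerSet (ι → ℕ)) {k : ℕ}
    (hk : ∀ A : Finset ι, (∀ N, ∃ μ ∈ Y, ∀ i ∈ A, N ≤ μ i) → ∑ i ∈ A, w i ≤ k) :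
    HasDenominator k (fun n => (weightedCount w Y n : ℚ)) := by
  let e := Fintype.equivFin ι
  let Z : LowerSet (Fin (Fintype.card ι) → ℕ) :=
    ⟨{μ | μ ∘ e ∈ Y}, fun a b hba ha => Y.lower (fun i => hba (e i)) ha⟩
  refine (hasDenominator_weightedCount_fin (w := w ∘ e.symm) (fun i => hw _) Z (k := k)
    fun A hA => ?_).congr fun n => ?_
  · have := hk (A.map e.symm.toEmbedding) fun N => by
      obtain ⟨μ, hμ, hN⟩ := hA N
      exact ⟨_, hμ, fun i hi => hN (e i) (by simpa using hi)⟩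
    simpa using this
  · have : {μ | μ ∈ (Z : Set _) ∧ ∑ i, (w ∘ e.symm) i * (μ i + 1) = n} =
        (fun μ => μ ∘ e.symm) '' {μ | μ ∈ (Y : Set _) ∧ ∑ i, w i * (μ i + 1) = n} := by
      ext μ
      constructor
      · rintro ⟨h1, h2⟩
        refine ⟨μ ∘ e, ⟨h1, ?_⟩, by ext; simp⟩
        rw [← h2, ← e.sum_comp]
        simp
      · rintro ⟨ν, ⟨h1, h2⟩, rfl⟩
        refine ⟨?_, ?_⟩
        · change (ν ∘ e.symm) ∘ e ∈ Y
          simpa [Function.comp_assoc] using h1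
        · rw [← h2, ← e.symm.sum_comp]
          simp
    unfold weightedCount
    rw [this, Set.ncard_image_of_injective]
    exact e.symm.surjective.injective_comp_right

end LowerSet

/-! ### Autonomous sets and acyclic components -/

namespace Tournament

variable {V V' ι ι' : Type*}

theorem adj_injective : Function.Injective (fun T : Tournament V => T.Adj) := by
  rintro ⟨⟨a⟩, _, _, _⟩ ⟨⟨b⟩, _, _, _⟩ h
  cases h
  rfl

/-- The pullback of a tournament along an injective map. -/
def comap (T : Tournament V) (f : V' → V) (hf : Function.Injective f) : Tournament V' where
  Adj x y := T.Adj (f x) (f y)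
  irrefl x := T.irrefl (f x)
  antisymm _ _ h h' := hf (T.antisymm _ _ h h')
  complete _ _ h := T.complete _ _ (hf.ne h)

/-- The acyclic tournament `0 → 1 → ⋯ → n - 1`. -/
def chain (n : ℕ) : Tournament (Fin n) where
  Adj x y := x < y
  irrefl := lt_irrefl
  antisymm _ _ h h' := absurd h h'.asymm
  complete _ _ h := lt_or_gt_of_ne h

theorem isAcyclic_chain (n : ℕ) : (chain n).IsAcyclic := fun _ _ _ h =>
  absurd (lt_trans (lt_trans h.1 h.2.1) h.2.2) (lt_irrefl _)

theorem IsAcyclic.of_embedding {T : Tournament V} {S : Tournament V'} (hS : S.IsAcyclic)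
    (f : T.Adj ↪r S.Adj) : T.IsAcyclic := fun a b c h =>
  hS (f a) (f b) (f c) ⟨f.map_rel_iff.2 h.1, f.map_rel_iff.2 h.2.1, f.map_rel_iff.2 h.2.2⟩

theorem isAcyclic_induce {T : Tournament V} {A : Set V} : (T.induce A).IsAcyclic ↔
    ∀ a ∈ A, ∀ b ∈ A, ∀ c ∈ A, ¬ (T.Adj a b ∧ T.Adj b c ∧ T.Adj c a) :=
  ⟨fun h a ha b hb c hc => h ⟨a, ha⟩ ⟨b, hb⟩ ⟨c, hc⟩, fun h a b c => h a a.2 b b.2 c c.2⟩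

theorem adj_iff_not_adj (T : Tournament V) {x y : V} (h : x ≠ y) : T.Adj x y ↔ ¬ T.Adj y x :=
  ⟨fun h1 h2 => h (T.antisymm _ _ h1 h2), fun h1 => (T.complete x y h).resolve_right h1⟩

theorem IsAutonomous.adj_right_iff {T : Tournament V} {A : Set V} (hA : T.IsAutonomous A)
    {x x' y : V} (hx : x ∈ A) (hx' : x' ∈ A) (hy : y ∉ A) : T.Adj y x ↔ T.Adj y x' := by
  have h1 : y ≠ x := fun h => hy (h ▸ hx)
  have h2 : y ≠ x' := fun h => hy (h ▸ hx')
  rw [T.adj_iff_not_adj h1, T.adj_iff_not_adj h2, hA x hx x' hx' y hy]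

/-- An autonomous set contains no exactly two vertices of a `3`-cycle. -/
theorem IsAutonomous.not_cycle {T : Tournament V} {A : Set V} (hA : T.IsAutonomous A)
    {x x' y : V} (hx : x ∈ A) (hx' : x' ∈ A) (hy : y ∉ A) : ¬ (T.Adj x y ∧ T.Adj y x') := by
  rintro ⟨h1, h2⟩
  have h3 := (hA x hx x' hx' y hy).1 h1
  have := T.antisymm _ _ h2 h3
  exact hy (this ▸ hx')

theorem IsAutonomous.sUnion {T : Tournament V} {𝒜 : Set (Set V)} {z : V}
    (h : ∀ A ∈ 𝒜, T.IsAutonomous A ∧ z ∈ A) : T.IsAutonomous (⋃₀ 𝒜) := by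
  rintro x ⟨A, hA, hx⟩ x' ⟨B, hB, hx'⟩ y hy
  have hyA : y ∉ A := fun h => hy ⟨A, hA, h⟩
  have hyB : y ∉ B := fun h => hy ⟨B, hB, h⟩
  exact ((h A hA).1 x hx z (h A hA).2 y hyA).trans ((h B hB).1 z (h B hB).2 x' hx' y hyB)

/-- A 3-cycle meets an acyclic autonomous set in at most one vertex. For a cycle `a → b → c → a`
with `a ∈ A` and `b ∈ B`, exchanging `b` for the common point `z` in `b → c`, and `a` for `z` in `c
→ a`, gives both `z → c` and `c → z`. -/
theorem isAcyclic_sUnion {T : Tournament V} {𝒜 : Set (Set V)} {z : V}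
    (h : ∀ A ∈ 𝒜, T.IsAutonomous A ∧ (T.induce A).IsAcyclic ∧ z ∈ A) :
    (T.induce (⋃₀ 𝒜)).IsAcyclic := by
  rw [isAcyclic_induce]
  rintro a ⟨A, hA, ha⟩ b ⟨B, hB, hb⟩ c ⟨C, hC, hc⟩ ⟨hab, hbc, hca⟩
  have key : ∀ A ∈ 𝒜, ∀ a b c, a ∈ A → T.Adj a b → T.Adj b c → T.Adj c a → b ∉ A ∧ c ∉ A := by
    intro A hA a b c ha hab hbc hca
    obtain ⟨h1, h2, -⟩ := h A hA
    by_cases hb : b ∈ A <;> by_cases hc : c ∈ A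
    · exact absurd ⟨hab, hbc, hca⟩ (isAcyclic_induce.1 h2 a ha b hb c hc)
    · exact absurd ⟨hbc, hca⟩ (h1.not_cycle hb ha hc)
    · exact absurd ⟨hab, hbc⟩ (h1.not_cycle ha hc hb)
    · exact ⟨hb, hc⟩
  obtain ⟨hbA, hcA⟩ := key A hA a b c ha hab hbc hca
  obtain ⟨hcB, haB⟩ := key B hB b c a hb hbc hca hab
  have hzA := (h A hA).2.2
  have hzB := (h B hB).2.2
  have hA1 := (h A hA).1
  have hB1 := (h B hB).1
  have h1 : T.Adj z b := (hA1 a ha z hzA b hbA).1 hab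
  have h2 : T.Adj z c := (hB1 b hb z hzB c hcB).1 hbc
  have h3 : T.Adj c z := (hA1.adj_right_iff ha hzA hcA).1 hca
  exact hcA (T.antisymm _ _ h2 h3 ▸ hzA)

theorem mem_acyclicComponent {T : Tournament V} {x y : V} : y ∈ T.acyclicComponent x ↔
    ∃ A, T.IsAutonomous A ∧ (T.induce A).IsAcyclic ∧ x ∈ A ∧ y ∈ A := by
  simp only [acyclicComponent, Set.mem_sUnion, Set.mem_ofPred_eq, and_assoc]

theorem isAutonomous_acyclicComponent (T : Tournament V) (x : V) :
    T.IsAutonomous (T.acyclicComponent x) :=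
  IsAutonomous.sUnion (z := x) fun _ hA => ⟨hA.1, hA.2.2⟩

theorem isAcyclic_acyclicComponent (T : Tournament V) (x : V) :
    (T.induce (T.acyclicComponent x)).IsAcyclic :=
  isAcyclic_sUnion (z := x) fun _ hA => hA

theorem mem_acyclicComponent_self (T : Tournament V) (x : V) : x ∈ T.acyclicComponent x := by
  refine mem_acyclicComponent.2 ⟨{x}, ?_, ?_, rfl, rfl⟩
  · rintro _ rfl _ rfl y -
    rfl
  · rw [isAcyclic_induce]
    rintro _ rfl _ rfl _ rfl h
    exact T.irrefl _ h.1

theorem acyclicComponent_eq_of_mem {T : Tournament V} {x y : V} (h : y ∈ T.acyclicComponent x) :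
    T.acyclicComponent y = T.acyclicComponent x := by
  have key : ∀ {x y : V}, y ∈ T.acyclicComponent x →
      T.acyclicComponent x ⊆ T.acyclicComponent y := fun {x y} h z hz =>
    mem_acyclicComponent.2 ⟨T.acyclicComponent x, T.isAutonomous_acyclicComponent x,
      T.isAcyclic_acyclicComponent x, h, hz⟩
  exact (key (key h (T.mem_acyclicComponent_self x))).antisymm (key h)

theorem mem_acyclicComponent_iff_eq {T : Tournament V} {x y : V} :
    y ∈ T.acyclicComponent x ↔ T.acyclicComponent y = T.acyclicComponent x :=
  ⟨acyclicComponent_eq_of_mem, fun h => h ▸ T.mem_acyclicComponent_self y⟩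

/-- Preimages of acyclic autonomous sets are acyclic and autonomous: passing to a subtournament can
merge components but never splits one. -/
theorem mem_acyclicComponent_of_embedding {T : Tournament V} {S : Tournament V'}
    (f : T.Adj ↪r S.Adj) {x y : V} (h : f y ∈ S.acyclicComponent (f x)) :
    y ∈ T.acyclicComponent x := by
  obtain ⟨A, hA, hA', hx, hy⟩ := mem_acyclicComponent.1 h
  refine mem_acyclicComponent.2 ⟨f ⁻¹' A, ?_, ?_, hx, hy⟩
  · intro x hx x' hx' y hy
    rw [← f.map_rel_iff, ← f.map_rel_iff (a := x')]
    exact hA _ hx _ hx' _ hy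
  · rw [isAcyclic_induce] at hA' ⊢
    intro a ha b hb c hc h
    exact hA' _ ha _ hb _ hc
      ⟨f.map_rel_iff.2 h.1, f.map_rel_iff.2 h.2.1, f.map_rel_iff.2 h.2.2⟩

/-! ### Reduced tournaments and decomposition into components -/

/-- A tournament is reduced if its acyclic autonomous sets have at most one element. -/
def IsReduced (D : Tournament ι) : Prop :=
  ∀ A : Set ι, D.IsAutonomous A → (D.induce A).IsAcyclic → A.Subsingleton

theorem IsReduced.of_iso {D : Tournament ι} {D' : Tournament ι'} (hD : D.IsReduced)
    (e : Iso D D') : D'.IsReduced := by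
  intro A hA hA' x hx y hy
  have h : y ∈ D'.acyclicComponent x := mem_acyclicComponent.2 ⟨A, hA, hA', hx, hy⟩
  have h' : e.symm y ∈ D.acyclicComponent (e.symm x) :=
    mem_acyclicComponent_of_embedding e.toRelEmbedding (by simpa using h)
  obtain ⟨B, hB, hB', hx', hy'⟩ := mem_acyclicComponent.1 h'
  exact e.symm.injective (hD B hB hB' hx' hy')

section LexSum

variable {W : ι → Type*} {W' : ι' → Type*} {D : Tournament ι} {S : ∀ i, Tournament (W i)}

theorem lexSum_adj {x y : Σ i, W i} : (lexSum D S).Adj x y ↔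
    D.Adj x.1 y.1 ∨ ∃ h : x.1 = y.1, (S y.1).Adj (h ▸ x.2) y.2 :=
  Sigma.lex_iff

theorem lexSum_adj_of_ne {x y : Σ i, W i} (h : x.1 ≠ y.1) :
    (lexSum D S).Adj x y ↔ D.Adj x.1 y.1 := by
  rw [lexSum_adj]
  exact or_iff_left fun ⟨h', _⟩ => h h'

theorem lexSum_adj_mk {i : ι} {x y : W i} :
    (lexSum D S).Adj ⟨i, x⟩ ⟨i, y⟩ ↔ (S i).Adj x y := by
  rw [lexSum_adj]
  exact ⟨fun h => h.elim (fun h => absurd h (D.irrefl i)) fun ⟨_, h⟩ => h, fun h => Or.inr ⟨rfl, h⟩⟩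

theorem isAutonomous_lexSum_fiber (i : ι) : (lexSum D S).IsAutonomous {x | x.1 = i} := by
  rintro x rfl x' hx' y hy
  have h1 : x.1 ≠ y.1 := fun h => hy h.symm
  have h2 : x'.1 ≠ y.1 := fun h => hy (h.symm.trans hx')
  rw [lexSum_adj_of_ne h1, lexSum_adj_of_ne h2, hx']

theorem isAcyclic_lexSum_fiber (hS : ∀ i, (S i).IsAcyclic) (i : ι) :
    ((lexSum D S).induce {x | x.1 = i}).IsAcyclic := by
  rw [isAcyclic_induce]
  rintro ⟨_, a⟩ rfl ⟨_, b⟩ rfl ⟨_, c⟩ rfl h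
  simp only [lexSum_adj_mk] at h
  exact hS _ a b c h

/-- The acyclic components of a lexicographical sum of nonempty acyclic tournaments indexed by a
reduced tournament are the summands. -/
theorem mem_acyclicComponent_lexSum (hD : D.IsReduced) (hS : ∀ i, (S i).IsAcyclic)
    [∀ i, Nonempty (W i)] {x y : Σ i, W i} :
    y ∈ (lexSum D S).acyclicComponent x ↔ y.1 = x.1 := by
  constructor
  · intro h
    obtain ⟨A, hA, hA', hx, hy⟩ := mem_acyclicComponent.1 h
    refine hD (Sigma.fst '' A) ?_ ?_ ⟨y, hy, rfl⟩ ⟨x, hx, rfl⟩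
    · rintro _ ⟨a, ha, rfl⟩ _ ⟨b, hb, rfl⟩ j hj
      obtain ⟨z⟩ := ‹∀ i, Nonempty (W i)› j
      have hz : (⟨j, z⟩ : Σ i, W i) ∉ A := fun h => hj ⟨_, h, rfl⟩
      have := hA a ha b hb _ hz
      rwa [lexSum_adj_of_ne fun h => hj ⟨a, ha, h⟩,
        lexSum_adj_of_ne fun h => hj ⟨b, hb, h⟩] at this
    · rw [isAcyclic_induce] at hA' ⊢
      rintro _ ⟨a, ha, rfl⟩ _ ⟨b, hb, rfl⟩ _ ⟨c, hc, rfl⟩ ⟨h1, h2, h3⟩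
      exact hA' a ha b hb c hc
        ⟨lexSum_adj.2 (Or.inl h1), lexSum_adj.2 (Or.inl h2), lexSum_adj.2 (Or.inl h3)⟩
  · intro h
    exact mem_acyclicComponent.2 ⟨{z | z.1 = x.1}, isAutonomous_lexSum_fiber _,
      isAcyclic_lexSum_fiber hS _, rfl, h⟩

/-- Embeddings of the index tournaments and of the summands combine to an embedding of
lexicographical sums. -/
def lexSumEmbedding {D' : Tournament ι'} {S' : ∀ i, Tournament (W' i)} (e : D.Adj ↪r D'.Adj)
    (f : ∀ i, (S i).Adj ↪r (S' (e i)).Adj) : (lexSum D S).Adj ↪r (lexSum D' S').Adj where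
  toFun := Sigma.map e fun i => f i
  inj' := e.injective.sigma_map fun i => (f i).injective
  map_rel_iff' {x y} := by
    obtain ⟨i, x⟩ := x
    obtain ⟨j, y⟩ := y
    simp only [Function.Embedding.coeFn_mk, Sigma.map]
    by_cases h : i = j
    · subst h
      rw [lexSum_adj_mk, lexSum_adj_mk, (f i).map_rel_iff]
    · rw [lexSum_adj_of_ne (by simpa using h), lexSum_adj_of_ne (by simpa using e.injective.ne h)]
      exact e.map_rel_iff

theorem nonempty_iso_lexSum {D' : Tournament ι'} {S' : ∀ i, Tournament (W' i)} (e : Iso D D')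
    (f : ∀ i, Iso (S i) (S' (e i))) : Nonempty (Iso (lexSum D S) (lexSum D' S')) := by
  let g := lexSumEmbedding (S := S) (S' := S') e.toRelEmbedding fun i => (f i).toRelEmbedding
  refine ⟨RelIso.ofSurjective g ?_⟩
  rintro ⟨j, y⟩
  obtain ⟨i, rfl⟩ := e.surjective j
  exact ⟨⟨i, (f i).symm y⟩, by
    change (⟨e i, f i ((f i).symm y)⟩ : Σ i, W' i) = _
    rw [RelIso.apply_symm_apply]⟩

/-- An isomorphism between lexicographical sums of nonempty acyclic tournaments indexed by reduced
tournaments comes from an isomorphism between the index tournaments. -/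
theorem exists_iso_index_of_iso_lexSum {D' : Tournament ι'} {S' : ∀ i, Tournament (W' i)}
    (hD : D.IsReduced) (hD' : D'.IsReduced) (hS : ∀ i, (S i).IsAcyclic)
    (hS' : ∀ i, (S' i).IsAcyclic) [∀ i, Nonempty (W i)] [∀ i, Nonempty (W' i)]
    (e : Iso (lexSum D S) (lexSum D' S')) :
    ∃ σ : Iso D D', ∀ i, Nonempty (W i ≃ W' (σ i)) := by
  -- Summands are acyclic components, and isomorphisms preserve these.
  have key : ∀ x y, (e x).1 = (e y).1 ↔ x.1 = y.1 := by
    intro x y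
    rw [← mem_acyclicComponent_lexSum hD' hS', ← mem_acyclicComponent_lexSum hD hS]
    refine ⟨mem_acyclicComponent_of_embedding e.toRelEmbedding, fun h => ?_⟩
    exact mem_acyclicComponent_of_embedding e.symm.toRelEmbedding (by simpa using h)
  choose p hp using fun i => (⟨⟨i, Classical.arbitrary (W i)⟩, rfl⟩ : ∃ x : Σ i, W i, x.1 = i)
  have hfst : ∀ x, (e x).1 = (e (p x.1)).1 := fun x => (key _ _).2 (hp _).symm
  let σ : ι → ι' := fun i => (e (p i)).1
  have hinj : Function.Injective σ := by
    intro i j h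
    have := (key _ _).1 h
    rwa [hp, hp] at this
  have hsurj : Function.Surjective σ := by
    intro j
    obtain ⟨x, hx⟩ := e.surjective ⟨j, Classical.arbitrary _⟩
    exact ⟨x.1, by rw [show σ x.1 = (e x).1 from (hfst x).symm, hx]⟩
  refine ⟨⟨Equiv.ofBijective σ ⟨hinj, hsurj⟩, ?_⟩, fun i => ?_⟩
  · intro i j
    by_cases h : i = j
    · subst h
      exact iff_of_false (D'.irrefl _) (D.irrefl _)
    · have h1 := e.map_rel_iff (a := p i) (b := p j)
      rw [lexSum_adj_of_ne fun h' => h (hinj h'), lexSum_adj_of_ne (by rwa [hp, hp]), hp,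
        hp] at h1
      exact h1
  · have h : ∀ x, x.1 = i ↔ (e x).1 = σ i := fun x => by rw [key, hp]
    exact ⟨(Equiv.sigmaSubtype i).symm.trans
      ((e.toEquiv.subtypeEquiv h).trans (Equiv.sigmaSubtype (σ i)))⟩

/-- A tournament is the lexicographical sum of its acyclic components, indexed by a reduced
tournament. -/
theorem exists_iso_lexSum_acyclicComponents (T : Tournament V) (c : ι ≃ T.acyclicComponents) :
    ∃ D : Tournament ι, D.IsReduced ∧
      Nonempty (Iso (lexSum D fun i => T.induce (c i : Set V)) T) := by
  have hne : ∀ i, ∃ x, T.acyclicComponent x = c i := fun i => (c i).2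
  choose g hg using hne
  have hmem : ∀ i x, x ∈ (c i : Set V) ↔ T.acyclicComponent x = c i := fun i x => by
    rw [← hg i, mem_acyclicComponent_iff_eq]
  have hginj : Function.Injective g := fun i j h =>
    c.injective (Subtype.ext (by rw [← hg i, ← hg j, h]))
  have haut : ∀ i, T.IsAutonomous (c i : Set V) := fun i =>
    hg i ▸ T.isAutonomous_acyclicComponent _
  have hac : ∀ i, (T.induce (c i : Set V)).IsAcyclic := fun i =>
    hg i ▸ T.isAcyclic_acyclicComponent _
  have huniq : ∀ i j x, x ∈ (c i : Set V) → x ∈ (c j : Set V) → i = j := fun i j x hi hj =>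
    c.injective (Subtype.ext (((hmem i x).1 hi).symm.trans ((hmem j x).1 hj)))
  let f : V → ι := fun x => c.symm ⟨T.acyclicComponent x, x, rfl⟩
  have hf : ∀ x, x ∈ (c (f x) : Set V) := fun x => by
    simpa [f] using T.mem_acyclicComponent_self x
  have hfg : ∀ i, g i ∈ (c i : Set V) := fun i => (hmem _ _).2 (hg i)
  have hadj : ∀ i j x y, x ∈ (c i : Set V) → y ∈ (c j : Set V) → i ≠ j →
      (T.Adj x y ↔ T.Adj (g i) (g j)) := by
    intro i j x y hx hy hij
    rw [haut i x hx (g i) (hfg i) y fun h => hij (huniq _ _ _ h hy),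
      (haut j).adj_right_iff hy (hfg j) fun h => hij (huniq _ _ _ (hfg i) h)]
  refine ⟨T.comap g hginj, ?_, ⟨⟨⟨fun x => x.2, fun x => ⟨f x, x, hf x⟩, ?_, ?_⟩, ?_⟩⟩⟩
  · intro A hA hA' i hi j hj
    -- The union of the components indexed by `A` is autonomous and acyclic in `T`, so it lies in a
    -- single component.
    have : g j ∈ T.acyclicComponent (g i) := by
      refine mem_acyclicComponent.2 ⟨f ⁻¹' A, ?_, ?_, ?_, ?_⟩
      · intro x hx x' hx' y hy
        have h1 : f x ≠ f y := fun h => hy (by rw [Set.mem_preimage, ← h]; exact hx)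
        have h2 : f x' ≠ f y := fun h => hy (by rw [Set.mem_preimage, ← h]; exact hx')
        rw [hadj _ _ x y (hf x) (hf y) h1, hadj _ _ x' y (hf x') (hf y) h2]
        exact hA _ hx _ hx' _ hy
      · rw [isAcyclic_induce] at hA' ⊢
        rintro a ha b hb d hd ⟨h1, h2, h3⟩
        -- A 3-cycle would lie in one component, or have exactly two vertices in one, or project to
        -- a 3-cycle in `A`.
        by_cases hab : f a = f b <;> by_cases hbd : f b = f d <;> by_cases hda : f d = f a
        · have hb' := hf b
          have hd' := hf d
          rw [← hab] at hb'
          rw [hda] at hd'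
          exact isAcyclic_induce.1 (hac (f a)) a (hf a) b hb' d hd' ⟨h1, h2, h3⟩
        · exact hda (hab.trans hbd).symm
        · exact hbd (hda.trans hab).symm
        · have hb' := hf b
          rw [← hab] at hb'
          exact (haut (f a)).not_cycle hb' (hf a)
            (fun h => hda (huniq _ _ _ (hf d) h)) ⟨h2, h3⟩
        · exact hab (hbd.trans hda).symm
        · have hd' := hf d
          rw [← hbd] at hd'
          exact (haut (f b)).not_cycle hd' (hf b)
            (fun h => hab (huniq _ _ _ (hf a) h)) ⟨h3, h1⟩
        · have ha' := hf a
          rw [← hda] at ha'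
          exact (haut (f d)).not_cycle ha' (hf d)
            (fun h => hbd (huniq _ _ _ (hf b) h)) ⟨h1, h2⟩
        · rw [hadj _ _ _ _ (hf a) (hf b) hab] at h1
          rw [hadj _ _ _ _ (hf b) (hf d) hbd] at h2
          rw [hadj _ _ _ _ (hf d) (hf a) hda] at h3
          exact hA' _ ha _ hb _ hd ⟨h1, h2, h3⟩
      · rw [Set.mem_preimage, huniq _ _ _ (hf (g i)) (hfg i)]
        exact hi
      · rw [Set.mem_preimage, huniq _ _ _ (hf (g j)) (hfg j)]
        exact hj
    rw [hg i] at this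
    exact huniq _ _ _ this (hfg j)
  · rintro ⟨i, x, hx⟩
    obtain rfl := huniq _ _ _ hx (hf x)
    rfl
  · intro x
    rfl
  · rintro ⟨i, x⟩ ⟨j, y⟩
    by_cases h : i = j
    · subst h
      exact (lexSum_adj_mk (S := fun i => T.induce (c i : Set V)) (x := x) (y := y)).symm
    · rw [lexSum_adj_of_ne h]
      exact hadj i j x y x.2 y.2 h

end LexSum

/-- A finite acyclic tournament is a chain. -/
theorem IsAcyclic.nonempty_iso_chain {T : Tournament V} (hT : T.IsAcyclic) [Finite V] :
    Nonempty (Iso (chain (Nat.card V)) T) := by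
  classical
  have : Fintype V := Fintype.ofFinite V
  have hto : IsStrictTotalOrder V T.Adj :=
    { irrefl := T.irrefl
      trichotomous := fun a b h1 h2 => by
        by_contra h
        exact (T.complete a b h).elim h1 h2
      trans := fun a b c hab hbc => by
        by_cases hac : a = c
        · subst hac
          have := T.antisymm _ _ hab hbc
          subst this
          exact hab
        · exact (T.complete a c hac).resolve_right fun hca => hT a b c ⟨hab, hbc, hca⟩ }
  let _ : LinearOrder V := linearOrderOfSTO T.Adj
  let e : Fin (Nat.card V) ≃o V := Fintype.orderIsoFinOfCardEq V Nat.card_eq_fintype_card.symm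
  exact ⟨⟨e.toEquiv, fun {a b} => e.lt_iff_lt⟩⟩

end Tournament

/-! ### Blow-ups by finite chains -/

namespace Tournament

variable {V V' ι ι' : Type*}

/-- The tournament `D` with each vertex `i` replaced by a chain with `l i + 1` elements. -/
def blowup (D : Tournament ι) (l : ι → ℕ) : Tournament (Σ i, Fin (l i + 1)) :=
  lexSum D fun i => chain (l i + 1)

/-- Uniqueness of the decomposition: the chains are the acyclic components, and finite chains are
determined by their cardinality. -/
theorem nonempty_iso_blowup_iff {D : Tournament ι} {D' : Tournament ι'} (hD : D.IsReduced)
    (hD' : D'.IsReduced) {l : ι → ℕ} {l' : ι' → ℕ} :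
    Nonempty (Iso (blowup D l) (blowup D' l')) ↔ ∃ σ : Iso D D', ∀ i, l' (σ i) = l i := by
  constructor
  · rintro ⟨e⟩
    obtain ⟨σ, hσ⟩ := exists_iso_index_of_iso_lexSum hD hD' (fun i => isAcyclic_chain _)
      (fun i => isAcyclic_chain _) e
    refine ⟨σ, fun i => ?_⟩
    have := Fin.equiv_iff_eq.1 (hσ i)
    omega
  · rintro ⟨σ, hσ⟩
    refine nonempty_iso_lexSum σ fun i => ?_
    rw [hσ i]

theorem nonempty_embedding_blowup_of_le (D : Tournament ι) {l l' : ι → ℕ} (h : l ≤ l') :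
    Nonempty ((blowup D l).Adj ↪r (blowup D l').Adj) :=
  ⟨lexSumEmbedding (RelEmbedding.refl _) fun i =>
    ⟨(Fin.castLEEmb (Nat.succ_le_succ (h i))), Iff.rfl⟩⟩

/-- Each acyclic component of a tournament meets at most one chain of an embedded blow-up of a
reduced tournament. -/
theorem eq_of_mem_acyclicComponent_of_blowup {T : Tournament V} {D : Tournament ι}
    (hD : D.IsReduced) {l : ι → ℕ} (f : (blowup D l).Adj ↪r T.Adj) {x y : Σ i, Fin (l i + 1)}
    (h : T.acyclicComponent (f x) = T.acyclicComponent (f y)) : x.1 = y.1 :=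
  (mem_acyclicComponent_lexSum hD fun _ => isAcyclic_chain _).1
    (mem_acyclicComponent_of_embedding f (mem_acyclicComponent_iff_eq.2 h))

theorem card_le_card_acyclicComponents {T : Tournament V} [Finite T.acyclicComponents]
    {D : Tournament ι} (hD : D.IsReduced) {l : ι → ℕ} (f : (blowup D l).Adj ↪r T.Adj) :
    Nat.card ι ≤ Nat.card T.acyclicComponents := by
  refine Nat.card_le_card_of_injective
    (fun i => (⟨T.acyclicComponent (f ⟨i, 0⟩), _, rfl⟩ : T.acyclicComponents)) fun i j h => ?_
  exact eq_of_mem_acyclicComponent_of_blowup hD f (Subtype.ext_iff.1 h)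

/-- If the chains indexed by `B` in embedded blow-ups of a reduced tournament can be arbitrarily
long, then there are at least `B.card` infinite acyclic components. -/
theorem card_le_ncard_infinite_acyclicComponents {T : Tournament V} [Finite T.acyclicComponents]
    {D : Tournament ι} (hD : D.IsReduced) (B : Finset ι)
    (hB : ∀ N, ∃ l : ι → ℕ, (∀ i ∈ B, N ≤ l i) ∧ Nonempty ((blowup D l).Adj ↪r T.Adj)) :
    B.card ≤ {A ∈ T.acyclicComponents | A.Infinite}.ncard := by
  let F : Set V := ⋃₀ {A ∈ T.acyclicComponents | ¬ A.Infinite}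
  have hF : F.Finite := by
    refine Set.Finite.sUnion ((Set.toFinite T.acyclicComponents).subset fun A hA => hA.1) ?_
    exact fun A hA => Set.not_infinite.1 hA.2
  -- A chain with more than `F.ncard` vertices must leave the finite set `F`, hence meet an infinite
  -- component.
  obtain ⟨l, hl, ⟨f⟩⟩ := hB F.ncard
  have h : ∀ i ∈ B, ∃ j, f ⟨i, j⟩ ∉ F := by
    intro i hi
    by_contra! h
    have h1 : (Set.range fun j => f ⟨i, j⟩).ncard ≤ F.ncard :=
      Set.ncard_le_ncard (Set.range_subset_iff.2 h) hF
    have hinj : Function.Injective fun j => f ⟨i, j⟩ := f.injective.comp sigma_mk_injective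
    rw [← Set.image_univ, Set.ncard_image_of_injective _ hinj, Set.ncard_univ, Nat.card_fin] at h1
    have := hl i hi
    omega
  choose! j hj using h
  rw [← Set.ncard_coe_finset]
  refine Set.ncard_le_ncard_of_injOn (fun i => T.acyclicComponent (f ⟨i, j i⟩)) ?_ ?_
    ((Set.toFinite T.acyclicComponents).subset fun A hA => hA.1)
  · intro i hi
    refine ⟨⟨_, rfl⟩, by_contra fun hfin => hj i hi ?_⟩
    exact ⟨_, ⟨⟨_, rfl⟩, hfin⟩, T.mem_acyclicComponent_self _⟩
  · intro i _ i' _ h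
    exact eq_of_mem_acyclicComponent_of_blowup hD f h

theorem exists_finset_iso_of_embedding {T : Tournament V} {S : Tournament V'} [Fintype V']
    (f : S.Adj ↪r T.Adj) :
    ∃ A : Finset V, A.card = Fintype.card V' ∧ Nonempty (Iso S (T.induce (A : Set V))) := by
  refine ⟨Finset.univ.map f.toEmbedding, by simp, ⟨⟨Equiv.ofBijective
    (fun x => ⟨f x, by simp⟩) ⟨fun x y h => f.injective (Subtype.ext_iff.1 h), ?_⟩, ?_⟩⟩⟩
  · rintro ⟨y, hy⟩
    obtain ⟨x, -, rfl⟩ := Finset.mem_map.1 (Finset.mem_coe.1 hy)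
    exact ⟨x, rfl⟩
  · intro a b
    exact f.map_rel_iff

/-- The restriction of a tournament embeds into it. -/
def induceEmbedding (T : Tournament V) (A : Set V) : (T.induce A).Adj ↪r T.Adj :=
  ⟨Function.Embedding.subtype _, Iff.rfl⟩

theorem exists_iso_blowup [Finite V] (T : Tournament V) :
    ∃ (D : Tournament (Fin (Nat.card T.acyclicComponents))) (l : Fin _ → ℕ), D.IsReduced ∧
      Nonempty (Iso (blowup D l) T) := by
  have : Finite T.acyclicComponents := Set.toFinite _
  let c : Fin (Nat.card T.acyclicComponents) ≃ T.acyclicComponents := (Finite.equivFin _).symm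
  obtain ⟨D, hD, ⟨e⟩⟩ := T.exists_iso_lexSum_acyclicComponents c
  have h : ∀ i, ∃ n, Nonempty (Iso (chain (n + 1)) (T.induce (c i : Set V))) := by
    intro i
    obtain ⟨x, hx⟩ := (c i).2
    have : Nonempty (c i : Set V) := ⟨⟨x, hx ▸ T.mem_acyclicComponent_self x⟩⟩
    have hac : (T.induce (c i : Set V)).IsAcyclic := hx ▸ T.isAcyclic_acyclicComponent x
    obtain ⟨n, hn⟩ := Nat.exists_eq_succ_of_ne_zero (Nat.card_pos (α := (c i : Set V))).ne'
    have hiso := hac.nonempty_iso_chain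
    rw [hn] at hiso
    exact ⟨n, hiso⟩
  choose l hl using h
  obtain ⟨g⟩ := nonempty_iso_lexSum (D' := D)
    (S' := fun i => T.induce (c i : Set V)) (RelIso.refl D.Adj) fun i => (hl i).some
  exact ⟨D, l, hD, ⟨g.trans e⟩⟩

/-! ### Configurations and Burnside's lemma -/

/-- The blow-ups, with `n` vertices, of reduced tournaments on `Fin r` that embed into `T`. -/
def Config (T : Tournament V) (r n : ℕ) : Type :=
  {p : Tournament (Fin r) × (Fin r → ℕ) // p.1.IsReduced ∧ ∑ i, (p.2 i + 1) = n ∧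
    Nonempty ((blowup p.1 p.2).Adj ↪r T.Adj)}

namespace Config

variable {T : Tournament V} {r n : ℕ}

instance : Finite (Tournament (Fin r)) := Finite.of_injective _ adj_injective

instance : Finite (Config T r n) := by
  have hfin := finite_setOf_weightedSum_eq (w := fun _ : Fin r => 1) (fun _ => one_pos) Set.univ n
  have := hfin.to_subtype
  refine Finite.of_injective (fun p : Config T r n =>
    ((p.1.1, ⟨p.1.2, trivial, by simpa using p.2.2.1⟩) : Tournament (Fin r) ×
      {μ : Fin r → ℕ | μ ∈ Set.univ ∧ ∑ i, 1 * (μ i + 1) = n})) ?_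
  intro p q h
  simp only [Prod.mk.injEq, Subtype.mk.injEq] at h
  exact Subtype.ext (Prod.ext h.1 h.2)

/-- The isomorphism from a tournament to its pullback along the inverse of a permutation. -/
def comapSymmIso (D : Tournament ι) (σ : Equiv.Perm ι) :
    Iso D (D.comap σ.symm σ.symm.injective) :=
  ⟨σ, by simp [comap]⟩

noncomputable instance : MulAction (Equiv.Perm (Fin r)) (Config T r n) where
  smul σ p := ⟨(p.1.1.comap σ.symm σ.symm.injective, p.1.2 ∘ σ.symm),
    p.2.1.of_iso (comapSymmIso _ σ),
    (σ.symm.sum_comp fun i => p.1.2 i + 1).trans p.2.2.1, by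
      have hred := p.2.1.of_iso (comapSymmIso p.1.1 σ)
      obtain ⟨e⟩ := (nonempty_iso_blowup_iff hred p.2.1
        (l := p.1.2 ∘ σ.symm) (l' := p.1.2)).2
        ⟨(comapSymmIso p.1.1 σ).symm, fun _ => rfl⟩
      exact p.2.2.2.map e.toRelEmbedding.trans⟩
  one_smul _ := rfl
  mul_smul _ _ _ := rfl

theorem mem_orbit_iff {p q : Config T r n} : p ∈ MulAction.orbit (Equiv.Perm (Fin r)) q ↔
    Nonempty (Iso (blowup p.1.1 p.1.2) (blowup q.1.1 q.1.2)) := by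
  rw [nonempty_iso_blowup_iff p.2.1 q.2.1]
  constructor
  · rintro ⟨σ, rfl⟩
    exact ⟨(comapSymmIso q.1.1 σ).symm, fun _ => rfl⟩
  · rintro ⟨σ, hσ⟩
    refine ⟨σ.symm.toEquiv, Subtype.ext (Prod.ext (adj_injective ?_) (funext hσ))⟩
    funext x y
    exact propext σ.map_rel_iff

theorem exists_finset_iso (p : Config T r n) : ∃ A : {A : Finset V // A.card = n},
    Nonempty (Iso (blowup p.1.1 p.1.2) (T.induce (A.1 : Set V))) := by
  obtain ⟨A, hA, hA'⟩ := exists_finset_iso_of_embedding p.2.2.2.some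
  refine ⟨⟨A, hA.trans ?_⟩, hA'⟩
  simpa using p.2.2.1

/-- The identity alone contributes the whole set to Burnside's sum. -/
theorem card_le_card_orbits_mul (T : Tournament V) (r n : ℕ) : Nat.card (Config T r n) ≤
    Nat.card (MulAction.orbitRel.Quotient (Equiv.Perm (Fin r)) (Config T r n)) * r.factorial := by
  classical
  have : Fintype (Config T r n) := Fintype.ofFinite _
  have h := MulAction.sum_card_fixedBy_eq_card_orbits_mul_card_group
    (Equiv.Perm (Fin r)) (Config T r n)
  rw [Fintype.card_perm, Fintype.card_fin] at h
  rw [Nat.card_eq_fintype_card, Nat.card_eq_fintype_card]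
  unfold MulAction.orbitRel.Quotient
  rw [← h]
  refine le_trans ?_ (Finset.single_le_sum (fun _ _ => Nat.zero_le _) (Finset.mem_univ 1))
  refine (Fintype.card_congr ?_).le
  exact (Equiv.Set.univ _).symm.trans (Equiv.setCongr (by ext; simp))

/-- Burnside's lemma; the division by `r!` is the reason for working over `ℚ`. -/
theorem hasDenominator_card_orbits {k r : ℕ} (T : Tournament V)
    (h : ∀ σ : Equiv.Perm (Fin r), HasDenominator k
      (fun n => (Nat.card (MulAction.fixedBy (Config T r n) σ) : ℚ))) :
    HasDenominator k (fun n => (Nat.card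
      (MulAction.orbitRel.Quotient (Equiv.Perm (Fin r)) (Config T r n)) : ℚ)) := by
  classical
  refine ((HasDenominator.sum Finset.univ fun σ _ => h σ).const_mul
    ((r.factorial : ℚ)⁻¹)).congr fun n => ?_
  have : Fintype (Config T r n) := Fintype.ofFinite _
  have h := MulAction.sum_card_fixedBy_eq_card_orbits_mul_card_group
    (Equiv.Perm (Fin r)) (Config T r n)
  rw [Fintype.card_perm, Fintype.card_fin] at h
  simp only [Nat.card_eq_fintype_card]
  rw [← Nat.cast_sum, h, Nat.cast_mul, mul_comm, mul_assoc,
    mul_inv_cancel₀ (by exact_mod_cast r.factorial_ne_zero), mul_one]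

/-- The lower set of the sizes, given by a function on a quotient of the index set, for which the
blow-up embeds into `T`. -/
def embeddableSizes {Q : Type*} (T : Tournament V) (D : Tournament ι) (π : ι → Q) :
    LowerSet (Q → ℕ) where
  carrier := {μ | Nonempty ((blowup D (μ ∘ π)).Adj ↪r T.Adj)}
  lower' := fun a b hba ⟨f⟩ =>
    (nonempty_embedding_blowup_of_le D (l := b ∘ π) (l' := a ∘ π) fun i => hba (π i)).map
      fun g => g.trans f

theorem comp_zpow_eq {α : Type*} {σ : Equiv.Perm ι} {l : ι → α} (h : l ∘ σ = l) (i : ℤ) (x : ι) :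
    l ((σ ^ i) x) = l x := by
  have h' : ∀ x, l (σ x) = l x := congrFun h
  induction i using Int.induction_on generalizing x with
  | zero => rfl
  | succ i ih => rw [zpow_add_one, Equiv.Perm.mul_apply, ih, h']
  | pred i ih =>
    rw [zpow_sub_one, Equiv.Perm.mul_apply, ih, ← h' (σ⁻¹ x)]
    exact congrArg l (σ.apply_symm_apply x)

/-- A fixed configuration is a `σ`-invariant `D` with sizes constant on the cycles of `σ`, that is,
a point of `embeddableSizes` weighted by cycle lengths. If the sizes are unbounded along a set of
cycles, all chains on these cycles become long together, so their number, the total weight, is at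
most that of the infinite components. -/
theorem hasDenominator_card_fixedBy (T : Tournament V) [Finite T.acyclicComponents]
    (σ : Equiv.Perm (Fin r)) :
    HasDenominator {A ∈ T.acyclicComponents | A.Infinite}.ncard
      (fun n => (Nat.card (MulAction.fixedBy (Config T r n) σ) : ℚ)) := by
  classical
  let Q := Quotient (Equiv.Perm.SameCycle.setoid σ)
  let π : Fin r → Q := Quotient.mk _
  have : Fintype Q := Fintype.ofFinite _
  let w : Q → ℕ := fun q => (Finset.univ.filter fun i => π i = q).card
  have hw : ∀ q, 0 < w q := fun q => by
    obtain ⟨i, rfl⟩ := Quotient.exists_rep q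
    exact Finset.card_pos.2 ⟨i, by simp [π]⟩
  have hπ : ∀ i, π (σ.symm i) = π i := fun i => Quotient.sound (show σ.SameCycle _ _ from
    ⟨1, by simp⟩)
  have hsum : ∀ μ : Q → ℕ, ∑ q, w q * (μ q + 1) = ∑ i, ((μ ∘ π) i + 1) := fun μ => by
    rw [← Finset.sum_fiberwise_of_maps_to (g := π) (t := Finset.univ) (by simp)]
    refine Finset.sum_congr rfl fun q _ => ?_
    rw [Finset.sum_congr rfl (g := fun _ => μ q + 1) fun i hi => by
      simp [(Finset.mem_filter.1 hi).2]]
    simp [w]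
  let 𝒟 := {D : Tournament (Fin r) // D.IsReduced ∧ D.comap σ.symm σ.symm.injective = D}
  have : Fintype 𝒟 := Fintype.ofFinite _
  have hD : ∀ D : 𝒟, HasDenominator {A ∈ T.acyclicComponents | A.Infinite}.ncard
      (fun n => (weightedCount w (embeddableSizes T D.1 π) n : ℚ)) := by
    intro D
    refine LowerSet.hasDenominator_weightedCount hw _ fun A hA => ?_
    have := card_le_ncard_infinite_acyclicComponents D.2.1
      (Finset.univ.filter fun i => π i ∈ A) (T := T) fun N => by
        obtain ⟨μ, hμ, hN⟩ := hA N
        exact ⟨μ ∘ π, fun i hi => hN _ (Finset.mem_filter.1 hi).2, hμ⟩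
    refine le_trans (le_of_eq ?_) this
    rw [Finset.card_eq_sum_card_fiberwise (f := π) (t := A) fun i hi => by simpa using hi]
    refine Finset.sum_congr rfl fun q hq => congrArg Finset.card (Finset.ext fun i => ?_)
    simp only [Finset.mem_filter, Finset.mem_univ, true_and]
    exact ⟨fun h => ⟨h ▸ hq, h⟩, fun h => h.2⟩
  refine (HasDenominator.sum Finset.univ fun D _ => hD D).congr fun n => ?_
  have hfin := fun D : 𝒟 => (finite_setOf_weightedSum_eq hw (embeddableSizes T D.1 π) n).to_subtype
  rw [← Nat.cast_sum]
  congr 1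
  unfold weightedCount
  simp only [← Nat.card_coe_set_eq]
  rw [← Nat.card_sigma]
  symm
  refine Nat.card_eq_of_bijective (fun x => ⟨⟨(x.1.1, x.2.1 ∘ π), x.1.2.1, ?_, ?_⟩, ?_⟩) ⟨?_, ?_⟩
  · exact (hsum _).symm.trans x.2.2.2
  · exact x.2.2.1
  · refine Subtype.ext (Prod.ext x.1.2.2 (funext fun i => ?_))
    exact congrArg x.2.1 (hπ i)
  · rintro ⟨D, μ⟩ ⟨D', μ'⟩ h
    have h1 := congrArg (fun p => p.1.1.1) h
    have h2 := congrArg (fun p => p.1.1.2) h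
    obtain rfl : D = D' := Subtype.ext h1
    have h3 : μ = μ' := Subtype.ext (Function.Surjective.injective_comp_right
      (Quotient.mk_surjective) h2)
    rw [h3]
  · rintro ⟨⟨⟨D, l⟩, hred, hn, hemb⟩, hfix⟩
    have hfix' : (D.comap σ.symm σ.symm.injective, l ∘ σ.symm) = (D, l) :=
      congrArg Subtype.val hfix
    obtain ⟨h1, h2⟩ := Prod.mk.inj hfix'
    have h2' : l ∘ σ = l := by
      funext i
      simpa using (congrFun h2 (σ i)).symm
    let μ : Q → ℕ := Quotient.lift l (by
      rintro i _ ⟨j, rfl⟩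
      exact (comp_zpow_eq h2' j i).symm)
    exact ⟨⟨⟨D, hred, h1⟩, ⟨μ, hemb, (hsum μ).trans hn⟩⟩, rfl⟩

end Config

/-- An induced tournament determines its number `r` of chains, at most the number of components of
`T`, and its configuration up to relabelling. Conversely every configuration is realised by a
subset. -/
theorem profile_eq_sum_card_orbits (T : Tournament V) [Finite T.acyclicComponents] (n : ℕ) :
    T.profile n = ∑ r : Fin (Nat.card T.acyclicComponents + 1), Nat.card
      (MulAction.orbitRel.Quotient (Equiv.Perm (Fin r)) (Config T r n)) := by
  rw [← Nat.card_sigma]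
  choose Φ hΦ using fun (r : ℕ) (p : Config T r n) => p.exists_finset_iso
  symm
  refine Nat.card_eq_of_bijective (fun x => Quotient.lift
    (fun p => (Quotient.mk (T.isoSetoid n) (Φ _ p))) ?_ x.2) ⟨?_, ?_⟩
  · intro p q hpq
    obtain ⟨e⟩ := Config.mem_orbit_iff.1 hpq
    obtain ⟨e1⟩ := hΦ _ p
    obtain ⟨e2⟩ := hΦ _ q
    exact Quotient.sound ⟨e1.symm.trans (e.trans e2)⟩
  · rintro ⟨⟨r, hr⟩, ⟨p⟩⟩ ⟨⟨r', hr'⟩, ⟨q⟩⟩ h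
    obtain ⟨e⟩ := Quotient.exact h
    obtain ⟨e1⟩ := hΦ _ p
    obtain ⟨e2⟩ := hΦ _ q
    have e3 : Iso (blowup p.1.1 p.1.2) (blowup q.1.1 q.1.2) := e1.trans (e.trans e2.symm)
    obtain ⟨σ, -⟩ := (nonempty_iso_blowup_iff p.2.1 q.2.1).1 ⟨e3⟩
    obtain rfl : r = r' := Fin.equiv_iff_eq.1 ⟨σ.toEquiv⟩
    have h : Quotient.mk (MulAction.orbitRel (Equiv.Perm (Fin r)) (Config T r n)) p =
        Quotient.mk _ q := Quotient.sound (Config.mem_orbit_iff.2 ⟨e3⟩)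
    exact congrArg (Sigma.mk (β := fun r : Fin (Nat.card T.acyclicComponents + 1) =>
      MulAction.orbitRel.Quotient (Equiv.Perm (Fin r)) (Config T r n)) ⟨r, hr⟩) h
  · rintro ⟨A, hA⟩
    obtain ⟨D, l, hD, ⟨e⟩⟩ := (T.induce (A : Set V)).exists_iso_blowup
    have f := e.toRelEmbedding.trans (T.induceEmbedding (A : Set V))
    have hr := card_le_card_acyclicComponents hD f
    rw [Nat.card_fin] at hr
    let p : Config T _ n := ⟨(D, l), hD, by
      have := Nat.card_congr e.toEquiv
      rw [Nat.card_sigma] at this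
      simp [hA] at this
      exact this, ⟨f⟩⟩
    refine ⟨⟨⟨_, Nat.lt_succ_of_le hr⟩, Quotient.mk _ p⟩, Quotient.sound ?_⟩
    obtain ⟨e1⟩ := hΦ _ p
    exact ⟨e1.symm.trans e⟩

theorem hasDenominator_profile (T : Tournament V) [Finite T.acyclicComponents] :
    HasDenominator {A ∈ T.acyclicComponents | A.Infinite}.ncard (fun n => (T.profile n : ℚ)) := by
  refine (HasDenominator.sum (Finset.univ : Finset (Fin (Nat.card T.acyclicComponents + 1)))
    fun r _ => Config.hasDenominator_card_orbits (r := r) T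
      fun σ => Config.hasDenominator_card_fixedBy T σ).congr fun n => ?_
  rw [profile_eq_sum_card_orbits, Nat.cast_sum]

end Tournament

/-! ### Finiteness of the components and a lower bound for the profile -/

namespace Tournament

variable {V V' ι ι' : Type*}

/-- Each summand is autonomous and acyclic, hence inside one component; one vertex chosen per
component then gives an injection into the index set. -/
theorem finite_acyclicComponents_of_iso_lexSum {W : ι → Type*} [Finite ι] {T : Tournament V}
    {D : Tournament ι} {S : ∀ i, Tournament (W i)} (hS : ∀ i, (S i).IsAcyclic)
    (e : Iso T (lexSum D S)) : Finite T.acyclicComponents := by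
  have h : ∀ x y, (e x).1 = (e y).1 → T.acyclicComponent x = T.acyclicComponent y := by
    intro x y hxy
    refine mem_acyclicComponent_iff_eq.1
      (mem_acyclicComponent_of_embedding e.toRelEmbedding (mem_acyclicComponent.2 ?_))
    exact ⟨_, isAutonomous_lexSum_fiber (e y).1, isAcyclic_lexSum_fiber hS _, rfl, hxy⟩
  have hmem : ∀ A : T.acyclicComponents, ∃ x, T.acyclicComponent x = A := fun A => A.2
  choose x hx using hmem
  refine Finite.of_injective (fun A => (e (x A)).1) fun A B hAB => Subtype.ext ?_
  rw [← hx A, ← hx B]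
  exact h _ _ hAB

theorem IsAcyclic.nonempty_chain_embedding [Infinite V] {T : Tournament V} (hT : T.IsAcyclic)
    (n : ℕ) : Nonempty ((chain n).Adj ↪r T.Adj) := by
  obtain ⟨A, hA⟩ := Infinite.exists_subset_card_eq V n
  have hac : (T.induce (A : Set V)).IsAcyclic := hT.of_embedding (T.induceEmbedding _)
  have hiso := hac.nonempty_iso_chain
  rw [show Nat.card (A : Set V) = n by simpa using hA] at hiso
  exact hiso.map fun e => e.toRelEmbedding.trans (T.induceEmbedding _)

/-- The blow-ups that put chains of arbitrary length in the infinite acyclic components and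
single vertices in the finite ones embed. -/
theorem exists_isReduced_forall_embedding (T : Tournament V) (c : ι ≃ T.acyclicComponents) :
    ∃ D : Tournament ι, D.IsReduced ∧ ∀ l : ι → ℕ, (∀ i, ¬ (c i : Set V).Infinite → l i = 0) →
      Nonempty ((blowup D l).Adj ↪r T.Adj) := by
  obtain ⟨D, hD, ⟨e⟩⟩ := T.exists_iso_lexSum_acyclicComponents c
  refine ⟨D, hD, fun l hl => ?_⟩
  have h : ∀ i, Nonempty ((chain (l i + 1)).Adj ↪r (T.induce (c i : Set V)).Adj) := by
    intro i
    obtain ⟨x, hx⟩ := (c i).2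
    by_cases hi : (c i : Set V).Infinite
    · have := hi.to_subtype
      have hac : (T.induce (c i : Set V)).IsAcyclic := hx ▸ T.isAcyclic_acyclicComponent x
      exact hac.nonempty_chain_embedding _
    · have : Subsingleton (Fin (0 + 1)) := inferInstanceAs (Subsingleton (Fin 1))
      rw [hl i hi]
      refine ⟨⟨⟨fun _ => ⟨x, hx ▸ T.mem_acyclicComponent_self x⟩, fun a b _ =>
        Subsingleton.elim _ _⟩, fun {a b} => ?_⟩⟩
      exact iff_of_false (T.irrefl x) (Subsingleton.elim a b ▸ (chain _).irrefl a)
  exact ⟨(lexSumEmbedding (S' := fun i => T.induce (c i : Set V)) (RelEmbedding.refl D.Adj)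
    fun i => (h i).some).trans e.toRelEmbedding⟩

theorem pow_le_card_config (T : Tournament V) {m k : ℕ} (c : Fin m ≃ T.acyclicComponents)
    (hk : Nat.card {i // (c i : Set V).Infinite} = k + 1) (N : ℕ) :
    N ^ k ≤ Nat.card (Config T m (m + (k + 1) * N)) := by
  classical
  obtain ⟨D, hD, hemb⟩ := T.exists_isReduced_forall_embedding c
  have : Nonempty {i // (c i : Set V).Infinite} :=
    (Nat.card_pos_iff.1 (by omega)).1
  obtain ⟨i₀, hi₀⟩ := this
  let J := {i // (c i : Set V).Infinite ∧ i ≠ i₀}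
  have hJ : Fintype.card J = k := by
    rw [Nat.card_eq_fintype_card, Fintype.card_subtype] at hk
    rw [Fintype.card_subtype]
    have h1 : (Finset.univ.filter fun i => (c i : Set V).Infinite ∧ i ≠ i₀) =
        (Finset.univ.filter fun i => (c i : Set V).Infinite).erase i₀ := by
      ext i
      simp [and_comm]
    rw [h1, Finset.card_erase_of_mem (by simpa using hi₀), hk, Nat.add_sub_cancel]
  -- The sizes on `J`, all infinite components but `i₀`, are free below `N`; `i₀` absorbs the
  -- remainder to fix the total. By `hle` the subtraction is not truncated.
  let l : (J → Fin N) → Fin m → ℕ := fun g i =>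
    if i = i₀ then (k + 1) * N - ∑ j, (g j : ℕ)
    else if h : (c i : Set V).Infinite ∧ i ≠ i₀ then g ⟨i, h⟩ else 0
  have hle : ∀ g : J → Fin N, ∑ j, (g j : ℕ) ≤ (k + 1) * N := fun g => by
    have h := Finset.sum_le_card_nsmul Finset.univ (fun j => (g j : ℕ)) N fun j _ => (g j).2.le
    rw [Finset.card_univ, hJ, smul_eq_mul] at h
    exact h.trans (Nat.mul_le_mul_right N k.le_succ)
  have hsum : ∀ g, ∑ i, (l g i + 1) = m + (k + 1) * N := fun g => by
    have h1 : ∑ i ∈ Finset.univ.erase i₀, l g i = ∑ j, (g j : ℕ) := by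
      have h2 : ∀ j : J, (g j : ℕ) = l g j.1 := fun j => by
        simp only [l, if_neg j.2.2, dif_pos j.2]
        rfl
      rw [Finset.sum_congr rfl fun j _ => h2 j, ← Finset.sum_subtype (Finset.univ.filter fun i =>
        (c i : Set V).Infinite ∧ i ≠ i₀) (by simp) (l g)]
      symm
      refine Finset.sum_subset (fun i hi => by simpa using (Finset.mem_filter.1 hi).2.2)
        fun i hi hi' => ?_
      have h3 : i ≠ i₀ := Finset.ne_of_mem_erase hi
      have h4 : ¬ ((c i : Set V).Infinite ∧ i ≠ i₀) := fun h => hi' (by simpa using h)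
      simp only [l, if_neg h3, dif_neg h4]
    rw [Finset.sum_add_distrib, ← Finset.add_sum_erase _ _ (Finset.mem_univ i₀), h1]
    have h2 : l g i₀ = (k + 1) * N - ∑ j, (g j : ℕ) := if_pos rfl
    have := hle g
    simp only [Finset.sum_const, Finset.card_univ, Fintype.card_fin, smul_eq_mul, mul_one]
    omega
  have hzero : ∀ g i, ¬ (c i : Set V).Infinite → l g i = 0 := by
    intro g i hi
    have h1 : i ≠ i₀ := fun h => hi (h ▸ hi₀)
    simp [l, h1, hi]
  let F : (J → Fin N) → Config T m (m + (k + 1) * N) := fun g =>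
    ⟨(D, l g), hD, hsum g, hemb _ (hzero g)⟩
  have hF : Function.Injective F := by
    intro g g' h
    have h1 : l g = l g' := congrArg (fun p => p.1.2) h
    funext j
    have h2 := congrFun h1 j.1
    simp only [l, if_neg j.2.2, dif_pos j.2] at h2
    exact Fin.ext h2
  have := Nat.card_le_card_of_injective F hF
  simpa [Nat.card_eq_fintype_card, hJ] using this

/-- Configurations with one chain in every component suffice, and passing to orbits costs at most a
factorial that does not depend on `N`. -/
theorem pow_le_profile_mul_factorial (T : Tournament V) [Finite T.acyclicComponents] {k : ℕ}
    (hk : {A ∈ T.acyclicComponents | A.Infinite}.ncard = k + 1) (N : ℕ) :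
    N ^ k ≤ T.profile (Nat.card T.acyclicComponents + (k + 1) * N) *
      (Nat.card T.acyclicComponents).factorial := by
  let c : Fin (Nat.card T.acyclicComponents) ≃ T.acyclicComponents := (Finite.equivFin _).symm
  have hc : Nat.card {i // (c i : Set V).Infinite} = k + 1 := by
    rw [← hk, ← Nat.card_coe_set_eq]
    let e₁ : {i // (c i : Set V).Infinite} ≃ {A : T.acyclicComponents // (A : Set V).Infinite} :=
      c.subtypeEquiv fun _ => Iff.rfl
    exact Nat.card_congr (e₁.trans
      (Equiv.subtypeSubtypeEquivSubtypeInter (· ∈ T.acyclicComponents) Set.Infinite))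
  refine (T.pow_le_card_config c hc N).trans
    ((Config.card_le_card_orbits_mul T _ _).trans (Nat.mul_le_mul_right _ ?_))
  rw [profile_eq_sum_card_orbits]
  exact Finset.single_le_sum (f := fun r : Fin (Nat.card T.acyclicComponents + 1) => Nat.card
      (MulAction.orbitRel.Quotient (Equiv.Perm (Fin r)) (Config T r _)))
    (fun _ _ => Nat.zero_le _) (Finset.mem_univ (Fin.last _))

end Tournament

/-- Since the limit is known to exist, a lower bound along one arithmetic progression is enough. -/
theorem pos_of_tendsto_div_pow {f : ℕ → ℕ} {k m M : ℕ} {a : ℝ}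
    (ha : Tendsto (fun n : ℕ => (f n : ℝ) / (n : ℝ) ^ k) atTop (𝓝 a))
    (hf : ∀ N, N ^ k ≤ f (m + (k + 1) * N) * M) : 0 < a := by
  have hlim : Tendsto (fun N : ℕ => m + (k + 1) * N) atTop atTop :=
    tendsto_atTop_mono (fun N => (Nat.le_mul_of_pos_left N k.succ_pos).trans
      (Nat.le_add_left _ _)) tendsto_id
  -- For `N > m`, the argument `m + (k + 1) * N` is at most `(k + 2) * N`.
  have h : 1 / ((k : ℝ) + 2) ^ k ≤ a * M := by
    refine ge_of_tendsto ((ha.comp hlim).mul_const (M : ℝ)) ?_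
    filter_upwards [eventually_ge_atTop (m + 1)] with N hN
    have hN' : (m : ℝ) + 1 ≤ N := by exact_mod_cast hN
    have hm : (0 : ℝ) ≤ m := m.cast_nonneg
    have hpos : (0 : ℝ) < ((m + (k + 1) * N : ℕ) : ℝ) := by
      push_cast
      have : (0 : ℝ) < N := by linarith
      positivity
    have hle : ((m + (k + 1) * N : ℕ) : ℝ) ≤ (k + 2) * N := by
      push_cast
      linarith
    have hfN : (N : ℝ) ^ k ≤ f (m + (k + 1) * N) * M := by exact_mod_cast hf N
    rw [Function.comp_apply, div_mul_eq_mul_div, div_le_div_iff₀ (by positivity) (by positivity),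
      one_mul]
    calc ((m + (k + 1) * N : ℕ) : ℝ) ^ k ≤ ((k + 2) * N) ^ k := by gcongr
      _ = N ^ k * (k + 2) ^ k := by rw [mul_pow, mul_comm]
      _ ≤ _ := by gcongr
  have h0 : 0 < a * M := lt_of_lt_of_le (by positivity) h
  exact pos_of_mul_pos_left h0 M.cast_nonneg

/-! ### The main theorem -/

theorem theorem6 {V I : Type*} {W : I → Type*} [Finite I]
    (T : Tournament V) (D : Tournament I) (S : ∀ i, Tournament (W i))
    (hS : ∀ i, (S i).IsAcyclic)
    (hT : Nonempty (Tournament.Iso T (Tournament.lexSum D S))) :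
    ∃ k : ℕ, {A ∈ T.acyclicComponents | A.Infinite}.encard = k ∧
      (∃ P : Polynomial ℤ,
        T.profileSeries * ∏ i ∈ Finset.Icc 1 k, (1 - PowerSeries.X ^ i) =
          (P : PowerSeries ℤ)) ∧
      ∃ a : ℝ, 0 ≤ a ∧ (1 ≤ k → 0 < a) ∧
        Asymptotics.IsEquivalent Filter.atTop (fun n : ℕ => (T.profile n : ℝ))
          (fun n : ℕ => a * (n : ℝ) ^ ((k : ℤ) - 1)) := by
  obtain ⟨e⟩ := hT
  have := Tournament.finite_acyclicComponents_of_iso_lexSum hS e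
  have hden := T.hasDenominator_profile
  have hfin : {A ∈ T.acyclicComponents | A.Infinite}.Finite :=
    (Set.toFinite T.acyclicComponents).subset fun A hA => hA.1
  refine ⟨{A ∈ T.acyclicComponents | A.Infinite}.ncard, hfin.cast_ncard_eq.symm,
    HasDenominator.exists_int_polynomial (by simpa using hden), ?_⟩
  rcases hk : {A ∈ T.acyclicComponents | A.Infinite}.ncard with _ | k
  · rw [hk] at hden
    -- For `k = 0` the denominator is the empty product, so the series is a polynomial; with `a = 0`
    -- the factor `n ^ (-1)` plays no role.
    refine ⟨0, le_rfl, fun h => absurd h (by simp), ?_⟩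
    simp only [zero_mul]
    refine Asymptotics.isEquivalent_zero_iff_eventually_zero.2 ?_
    filter_upwards [hden.eventually_eq_zero] with n hn
    exact Nat.cast_eq_zero.2 (Nat.cast_eq_zero.1 hn)
  · rw [hk] at hden
    obtain ⟨a, ha⟩ := hden.exists_tendsto
    simp only [Rat.cast_natCast] at ha
    have hpos : 0 < a := pos_of_tendsto_div_pow ha (T.pow_le_profile_mul_factorial hk)
    refine ⟨a, hpos.le, fun _ => hpos, ?_⟩
    have hexp : ((k + 1 : ℕ) : ℤ) - 1 = k := by simp
    simp only [hexp, zpow_natCast]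
    refine Asymptotics.isEquivalent_of_tendsto_one ?_
    have h1 := ha.div_const a
    rw [div_self hpos.ne'] at h1
    refine h1.congr fun n => ?_
    simp [div_div, mul_comm]
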